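/- Fix $m\ge 1$ and the language of $m$ binary relation symbols $s_1,\dots,s_m$. A topological structure is a compact zero-dimensional second-countable (Hausdorff) space with $m$ closed binary relations; finite structures carry the discrete topology. An epimorphism $\varphi\colon B\to A$ is a continuous surjection such that, for every $i$, $s_i^A=\{(\varphi(x),\varphi(y)) : (x,y)\in s_i^B\}$; an isomorphism is a bijective epimorphism. A relation $s$ on $A$ is surjective if every $a\in A$ has some $b$ with $s(a,b)$ and some $c$ with $s(c,a)$. For a binary relation $R$ on $A$, a point $x$ is $R$-outgoing if there is more than one $z$ with $R(x,z)$ and exactly one $y$ with $R(y,x)$; it is $R$-incoming if there is more than one $y$ with $R(y,x)$ and exactly one $z$ with $R(x,z)$. Let $\mathcal F$ be the family of finite non-empty structures $A$ whose relations $s_1^A,\dots,s_m^A$ are surjective and which satisfy: (i) every point $x\in A$ is $R$-outgoing for exactly one $R$ among $s_1^A,(s_1^A)^{-1},\dots,s_m^A,(s_m^A)^{-1}$, and for each of the other $2m-1$ relations $R$ in this list there is exactly one $y$ with $R(x,y)$; (ii) for every $i$, if $s_i^A(x,y)$, then $x$ is $s_i^A$-outgoing or $y$ is $s_i^A$-incoming.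 A projective Fraïssé limit of $\mathcal F$ is a topological structure $\mathbb L$ such that: (L1) for every $A\in\mathcal F$ there is an epimorphism $\mathbb L\to A$; (L2) every continuous map $f$ from $\mathbb L$ to a finite discrete space factors as $f=f_0\circ\varphi$ with $\varphi\colon\mathbb L\to A$ an epimorphism onto some $A\in\mathcal F$; (L3) for all epimorphisms $\varphi_1,\varphi_2\colon\mathbb L\to A$ with $A\in\mathcal F$ there is an isomorphism $\psi\colon\mathbb L\to\mathbb L$ with $\varphi_2=\varphi_1\circ\psi$. **Theorem.** $\mathcal F$ is a projective Fraïssé family: any two members are epimorphic images of a common member of $\mathcal F$, and for any epimorphisms $\varphi_1\colon B_1\to A$, $\varphi_2\colon B_2\to A$ between members of $\mathcal F$ there are $C\in\mathcal F$ and epimorphisms $\varphi_3\colon C\to B_1$, $\varphi_4\colon C\to B_2$ with $\varphi_1\circ\varphi_3=\varphi_2\circ\varphi_4$. It has a projective Fraïssé limit, and any two projective Fraïssé limits of $\mathcal F$ are isomorphic. For every projective Fraïssé limit $\mathbb L$ of $\mathcal F$, the space $\mathbb L$ is homeomorphic to the Cantor set $2^{\mathbb N}$; the relations $s_1^{\mathbb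 L},\dots,s_m^{\mathbb L}$ are graphs of homeomorphisms $F_1,\dots,F_m$ of $\mathbb L$; and for every homeomorphism $e\colon\mathbb L\to 2^{\mathbb N}$ the tuple $(eF_1e^{-1},\dots,eF_me^{-1})$ is generic in $H(2^{\mathbb N})^m$: its diagonal conjugacy class $\{(g\,eF_1e^{-1}g^{-1},\dots,g\,eF_me^{-1}g^{-1}) : g\in H(2^{\mathbb N})\}$ is dense, $G_\delta$ and comeager. Here $H(2^{\mathbb N})$ is the group of homeomorphisms of $2^{\mathbb N}$ with the topology of uniform convergence. -/

import Mathlib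

open Set Topology

universe u v

/-- A topological structure for the language of `m` binary relation symbols: a compact
zero-dimensional second-countable (Hausdorff) space with `m` closed binary relations.
A compact Hausdorff space is zero-dimensional iff it is totally disconnected. -/
structure TopStr (m : ℕ) where
  carrier : Type u
  [top : TopologicalSpace carrier]
  [compact : CompactSpace carrier]
  [t2 : T2Space carrier]
  [zeroDim : TotallyDisconnectedSpace carrier]
  [secondCountable : SecondCountableTopology carrier]
  rel : Fin m → carrier → carrier → Prop
  isClosed_rel : ∀ i, IsClosed {p : carrier × carrier | rel i p.1 p.2}

namespace TopStr

instance (m : ℕ) : CoeSort (TopStr.{u} m) (Type u) := ⟨TopStr.carrier⟩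

attribute [instance] TopStr.top TopStr.compact TopStr.t2 TopStr.zeroDim TopStr.secondCountable

variable {m : ℕ}

/-- Epimorphisms: continuous surjections such that each relation of the target is exactly the
image of the corresponding relation of the source. -/
structure IsEpi (B : TopStr.{u} m) (A : TopStr.{v} m) (φ : B → A) : Prop where
  continuous : Continuous φ
  surjective : Function.Surjective φ
  rel_iff : ∀ i x y, A.rel i x y ↔ ∃ x' y', φ x' = x ∧ φ y' = y ∧ B.rel i x' y'

/-- Isomorphisms: bijective epimorphisms. -/
def IsIso (B : TopStr.{u} m) (A : TopStr.{v} m) (φ : B → A) : Prop :=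
  Function.Bijective φ ∧ IsEpi B A φ

/-- The relation named by one of the `2m` symbols `s₁, s₁⁻¹, …, sₘ, sₘ⁻¹`: the pair `(i, true)`
stands for `sᵢ`, and the pair `(i, false)` for its inverse. -/
def signedRel (A : TopStr.{u} m) (R : Fin m × Bool) (x y : A) : Prop :=
  if R.2 = true then A.rel R.1 x y else A.rel R.1 y x

end TopStr

/-- A projective Fraïssé family of finite structures: joint projection and amalgamation. -/
structure IsProjFraisseFamily {m : ℕ} (𝓕 : TopStr.{0} m → Prop) : Prop where
  finite : ∀ A, 𝓕 A → Finite A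
  jpp : ∀ A B, 𝓕 A → 𝓕 B → ∃ C, 𝓕 C ∧
    (∃ φ : C → A, TopStr.IsEpi C A φ) ∧ (∃ ψ : C → B, TopStr.IsEpi C B ψ)
  ap : ∀ A B₁ B₂, 𝓕 A → 𝓕 B₁ → 𝓕 B₂ → ∀ (φ₁ : B₁ → A) (φ₂ : B₂ → A),
    TopStr.IsEpi B₁ A φ₁ → TopStr.IsEpi B₂ A φ₂ →
    ∃ C, 𝓕 C ∧ ∃ (φ₃ : C → B₁) (φ₄ : C → B₂),
      TopStr.IsEpi C B₁ φ₃ ∧ TopStr.IsEpi C B₂ φ₄ ∧ φ₁ ∘ φ₃ = φ₂ ∘ φ₄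

/-- `L` is a projective Fraïssé limit of the family `𝓕` of finite structures. -/
structure IsProjFraisseLimit {m : ℕ} (𝓕 : TopStr.{0} m → Prop) (L : TopStr.{u} m) : Prop where
  /-- projective universality -/
  universal : ∀ A, 𝓕 A → ∃ φ : L → A, TopStr.IsEpi L A φ
  /-- continuous maps to finite discrete spaces factor through epimorphisms onto members -/
  factor : ∀ (X : Type) [Finite X] [TopologicalSpace X] [DiscreteTopology X] (f : L → X),
    Continuous f → ∃ A, 𝓕 A ∧ ∃ (φ : L → A) (f₀ : A → X), TopStr.IsEpi L A φ ∧ f = f₀ ∘ φ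
  /-- projective ultrahomogeneity -/
  ultrahomogeneous : ∀ A, 𝓕 A → ∀ φ₁ φ₂ : L → A, TopStr.IsEpi L A φ₁ → TopStr.IsEpi L A φ₂ →
    ∃ ψ : L → L, TopStr.IsIso L L ψ ∧ φ₂ = φ₁ ∘ ψ

/-- A surjective relation: every point has a successor and a predecessor. -/
def IsSurjRel {A : Type u} (r : A → A → Prop) : Prop :=
  ∀ a, (∃ b, r a b) ∧ ∃ c, r c a

/-- More than one successor, and exactly one predecessor. -/
def IsOutgoing {A : Type u} (r : A → A → Prop) (x : A) : Prop :=
  (∃ z w, z ≠ w ∧ r x z ∧ r x w) ∧ ∃! y, r y x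

/-- More than one predecessor, and exactly one successor. -/
def IsIncoming {A : Type u} (r : A → A → Prop) (x : A) : Prop :=
  (∃ y w, y ≠ w ∧ r y x ∧ r w x) ∧ ∃! z, r x z

/-- The family of finite non-empty structures with `m` surjective relations such that
(i) every point is outgoing for exactly one of the `2m` relations `s₁, s₁⁻¹, …, sₘ, sₘ⁻¹`, and
has exactly one successor in each of the other ones;
(ii) for every edge of each `sᵢ`, its origin is `sᵢ`-outgoing or its end is `sᵢ`-incoming.
The topology of a finite Hausdorff space is discrete. -/
structure AmpleFamily (m : ℕ) (A : TopStr.{0} m) : Prop where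
  finite : Finite A
  nonempty : Nonempty A
  surjRel : ∀ i, IsSurjRel (A.rel i)
  one : ∀ x : A, (∃! R : Fin m × Bool, IsOutgoing (A.signedRel R) x) ∧
    ∀ R : Fin m × Bool, ¬ IsOutgoing (A.signedRel R) x → ∃! y, A.signedRel R x y
  two : ∀ i x y, A.rel i x y → IsOutgoing (A.rel i) x ∨ IsIncoming (A.rel i) y

/-- The topology of the homeomorphism group, induced by the compact-open topology on continuous
self-maps. For a compact metrizable space this is the topology of uniform convergence, which is
a Polish group topology. -/
instance homeoGroupTopology (X : Type u) [TopologicalSpace X] : TopologicalSpace (X ≃ₜ X) :=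
  TopologicalSpace.induced (fun f => (⟨f, f.continuous⟩ : C(X, X))) inferInstance

/-- The diagonal conjugacy class of an `m`-tuple of elements of a group. -/
def diagConjClass {G : Type u} [Group G] {m : ℕ} (f : Fin m → G) : Set (Fin m → G) :=
  {h | ∃ g : G, ∀ i, h i = g * f i * g⁻¹}

/-!
The members of the family are best seen as finite approximations to actions of the free group on
`m` generators: each point has one direction, a signed relation `R` along which it branches, while
along every other signed relation its neighbour is unique and has its own direction pointing back
(`ampleFamily_iff`).

Amalgamation uses this rigidity. Over `φ₁ : B₁ → A` and `φ₂ : B₂ → A`, keep those pairs of the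
fibre product from which one can walk forever along the directions of the common image in `A`
(`Threaded`). Away from the direction a step is forced in `A`, so it can be made in both coordinates
and leads to a pair whose direction points back; hence these pairs carry surjective relations. Every
edge of `B₁` lifts to such pairs: walk along the directions for `n` steps, lift the last edge to
`B₂`, and come back along forced edges; then let `n` grow. The amalgam obtained has surjective
relations but need not lie in the family, which is repaired by the fact that every finite structure
with surjective relations is covered by a member, even so that the neighbours of a point along one
signed relation have a single image (`TopStr.FinSurj.exists_cover`).

Ultrahomogeneity is equivalent, in the presence of the other two clauses, to an extension property
for epimorphisms (`isProjFraisseLimit_iff`), by a back and forth argument that also yields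
uniqueness; for the empty language the same argument gives the homeomorphism of any two Cantor
spaces over given finite partitions (`exists_homeomorph_over`). The limit is built as a structure on
a Cantor space by a sequence of finite quotients which is generic for countably many requirements
(`exists_generic`).

In a limit, the one-image property of the covers makes each relation the graph of a homeomorphism,
and branching excludes isolated points. By uniqueness of the limit, the conjugacy class consists of
the tuples whose graphs form a limit (`diagConjClass_eq`). This is a countable conjunction of open
conditions on the tuple, since being an epimorphism onto a finite structure is a clopen condition.
The class is dense because a basic neighbourhood of a tuple `k` is given by the quotient of `k` by
a finite clopen partition, which has surjective relations and hence is an epimorphic image of the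
limit.
-/

universe w

open TopologicalSpace (Clopens)

/-! ### Signed relations, epimorphisms and directions -/

namespace TopStr

variable {m : ℕ}

/-- The finite discrete structure with given relations. -/
def ofFinite (K : Type u) [Finite K] (r : Fin m → K → K → Prop) : TopStr.{u} m :=
  letI : TopologicalSpace K := ⊥
  haveI : DiscreteTopology K := ⟨rfl⟩
  { carrier := K, rel := r, isClosed_rel := fun _ => isClosed_discrete _ }

theorem continuous_of_finite {A : TopStr.{u} m} [Finite A] {Y : Type v} [TopologicalSpace Y]
    (f : A → Y) : Continuous f := continuous_of_discreteTopology

/-- The inverse of a signed relation symbol. -/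
def invSign (R : Fin m × Bool) : Fin m × Bool := (R.1, !R.2)

@[simp] theorem invSign_invSign (R : Fin m × Bool) : invSign (invSign R) = R := by
  simp [invSign]

theorem invSign_ne (R : Fin m × Bool) : invSign R ≠ R := by
  intro h
  have := congrArg Prod.snd h
  simp [invSign] at this

theorem signedRel_invSign (A : TopStr.{u} m) (R : Fin m × Bool) (x y : A) :
    A.signedRel (invSign R) x y ↔ A.signedRel R y x := by
  obtain ⟨i, b⟩ := R
  cases b <;> simp [signedRel, invSign]

theorem signedRel_of_forall {A : TopStr.{u} m} {E : Fin m × Bool → A → A → Prop}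
    (hE : ∀ R x y, E (invSign R) x y ↔ E R y x) (hA : ∀ i x y, A.rel i x y ↔ E (i, true) x y)
    (R : Fin m × Bool) (x y : A) : A.signedRel R x y ↔ E R x y := by
  obtain ⟨i, b⟩ := R
  cases b
  · simpa [signedRel, hA, invSign] using (hE (i, true) x y).symm
  · simp [signedRel, hA]

theorem IsEpi.signedRel_iff {B : TopStr.{u} m} {A : TopStr.{v} m} {φ : B → A} (h : IsEpi B A φ)
    (R : Fin m × Bool) (x y : A) :
    A.signedRel R x y ↔ ∃ x' y', φ x' = x ∧ φ y' = y ∧ B.signedRel R x' y' := by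
  obtain ⟨i, b⟩ := R
  cases b
  · simp only [signedRel, Bool.false_eq_true, if_false, h.rel_iff]
    constructor <;> rintro ⟨x', y', h1, h2, h3⟩ <;> exact ⟨y', x', h2, h1, h3⟩
  · simp only [signedRel, if_true, h.rel_iff]

theorem IsEpi.map {B : TopStr.{u} m} {A : TopStr.{v} m} {φ : B → A} (h : IsEpi B A φ)
    {R : Fin m × Bool} {x y : B} (hxy : B.signedRel R x y) : A.signedRel R (φ x) (φ y) :=
  (h.signedRel_iff R _ _).2 ⟨x, y, rfl, rfl, hxy⟩

theorem IsEpi.comp {C : TopStr.{w} m} {B : TopStr.{u} m} {A : TopStr.{v} m} {φ : B → A}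
    {ψ : C → B} (h : IsEpi B A φ) (h' : IsEpi C B ψ) : IsEpi C A (φ ∘ ψ) where
  continuous := h.continuous.comp h'.continuous
  surjective := h.surjective.comp h'.surjective
  rel_iff i x y := by
    rw [h.rel_iff]
    constructor
    · rintro ⟨x', y', rfl, rfl, hr⟩
      obtain ⟨x'', y'', rfl, rfl, hr'⟩ := (h'.rel_iff _ _ _).1 hr
      exact ⟨x'', y'', rfl, rfl, hr'⟩
    · rintro ⟨x', y', rfl, rfl, hr⟩
      exact ⟨_, _, rfl, rfl, (h'.rel_iff _ _ _).2 ⟨_, _, rfl, rfl, hr⟩⟩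

/-- If a composite is an epimorphism and so is its first map, then its second map, continuous
because its source is finite, is an epimorphism. -/
theorem IsEpi.of_comp {C : TopStr.{w} m} {B : TopStr.{u} m} {A : TopStr.{v} m} [Finite B]
    {φ : B → A} {ψ : C → B} (h : IsEpi C A (φ ∘ ψ)) (h' : IsEpi C B ψ) : IsEpi B A φ where
  continuous := continuous_of_finite φ
  surjective := h.surjective.of_comp
  rel_iff i x y := by
    rw [h.rel_iff]
    constructor
    · rintro ⟨x', y', rfl, rfl, hr⟩
      exact ⟨_, _, rfl, rfl, (h'.rel_iff _ _ _).2 ⟨_, _, rfl, rfl, hr⟩⟩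
    · rintro ⟨x', y', rfl, rfl, hr⟩
      obtain ⟨x'', y'', rfl, rfl, hr'⟩ := (h'.rel_iff _ _ _).1 hr
      exact ⟨x'', y'', rfl, rfl, hr'⟩

/-- Finite non-empty structures with surjective relations. -/
structure FinSurj (A : TopStr.{0} m) : Prop where
  finite : Finite A
  nonempty : Nonempty A
  surj : ∀ R x, ∃ y, A.signedRel R x y

theorem FinSurj.exists_pred {A : TopStr.{0} m} (hA : FinSurj A) (R : Fin m × Bool) (x : A) :
    ∃ y, A.signedRel R y x := by
  obtain ⟨y, hy⟩ := hA.surj (invSign R) x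
  exact ⟨y, (A.signedRel_invSign R x y).1 hy⟩

/-- The structure pulled back along a surjection of finite sets. -/
def pullback (A : TopStr.{0} m) (K : Type) [Finite K] (π : K → A) : TopStr.{0} m :=
  ofFinite K fun i x y => A.rel i (π x) (π y)

theorem isEpi_pullback (A : TopStr.{0} m) (K : Type) [Finite K] {π : K → A}
    (hπ : Function.Surjective π) : IsEpi (A.pullback K π) A π where
  continuous :=
    haveI : Finite (A.pullback K π) := ‹Finite K›
    continuous_of_finite (A := A.pullback K π) _
  surjective := hπ
  rel_iff i x y := by
    constructor
    · intro h
      obtain ⟨x, rfl⟩ := hπ x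
      obtain ⟨y, rfl⟩ := hπ y
      exact ⟨x, y, rfl, rfl, h⟩
    · rintro ⟨x, y, rfl, rfl, h⟩
      exact h

theorem FinSurj.pullback {A : TopStr.{0} m} (hA : FinSurj A) (K : Type) [Finite K] {π : K → A}
    (hπ : Function.Surjective π) : FinSurj (A.pullback K π) where
  finite := ‹Finite K›
  nonempty := by
    obtain ⟨a⟩ := hA.nonempty
    exact ⟨(hπ a).choose⟩
  surj R x := by
    obtain ⟨y, hy⟩ := hA.surj R (π x)
    obtain ⟨y, rfl⟩ := hπ y
    refine ⟨y, ?_⟩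
    exact (signedRel_of_forall (A := A.pullback K π) (E := fun R x y => A.signedRel R (π x) (π y))
      (fun R _ _ => A.signedRel_invSign R _ _) (fun _ _ _ => Iff.rfl) R x y).2 hy

end TopStr

open TopStr

variable {m : ℕ}

/-- A direction assigns to each point the signed relation along which it branches. Along the other
signed relations the neighbour is unique and, by `edge`, its direction points back. -/
structure IsDirection (A : TopStr.{0} m) (τ : A → Fin m × Bool) : Prop where
  unique : ∀ x R, R ≠ τ x → ∃! y, A.signedRel R x y
  branch : ∀ x, ∃ z w, z ≠ w ∧ A.signedRel (τ x) x z ∧ A.signedRel (τ x) x w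
  edge : ∀ R x y, A.signedRel R x y → τ x = R ∨ τ y = invSign R

theorem isOutgoing_signedRel_iff {A : TopStr.{0} m} {R : Fin m × Bool} {x : A} :
    IsOutgoing (A.signedRel R) x ↔
      (∃ z w, z ≠ w ∧ A.signedRel R x z ∧ A.signedRel R x w) ∧
        ∃! y, A.signedRel (invSign R) x y := by
  simp only [IsOutgoing, signedRel_invSign]

theorem isIncoming_rel_iff {A : TopStr.{0} m} {i : Fin m} {x : A} :
    IsIncoming (A.rel i) x ↔ IsOutgoing (A.signedRel (i, false)) x := by
  simp [IsIncoming, IsOutgoing, signedRel]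

theorem isOutgoing_rel_iff {A : TopStr.{0} m} {i : Fin m} {x : A} :
    IsOutgoing (A.rel i) x ↔ IsOutgoing (A.signedRel (i, true)) x := by
  simp [IsOutgoing, signedRel]

theorem IsDirection.isOutgoing_iff {A : TopStr.{0} m} {τ : A → Fin m × Bool}
    (h : IsDirection A τ) (R : Fin m × Bool) (x : A) :
    IsOutgoing (A.signedRel R) x ↔ τ x = R := by
  rw [isOutgoing_signedRel_iff]
  constructor
  · rintro ⟨⟨z, w, hzw, hz, hw⟩, -⟩
    by_contra hne
    exact hzw ((h.unique x R (Ne.symm hne)).unique hz hw)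
  · rintro rfl
    exact ⟨h.branch x, h.unique x _ (invSign_ne _)⟩

/-- Membership in the family in terms of a direction. -/
theorem ampleFamily_iff {A : TopStr.{0} m} :
    AmpleFamily m A ↔ Finite A ∧ Nonempty A ∧ ∃ τ, IsDirection A τ := by
  constructor
  · intro h
    choose τ hτ hτ' using fun x => (h.one x).1
    have hu : ∀ x R, R ≠ τ x → ∃! y, A.signedRel R x y := fun x R hR =>
      (h.one x).2 R fun h' => hR (hτ' x R h')
    refine ⟨h.finite, h.nonempty, τ, hu, fun x => (hτ x).1, ?_⟩
    have key : ∀ i x y, A.rel i x y → τ x = (i, true) ∨ τ y = (i, false) := by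
      intro i x y hxy
      rcases h.two i x y hxy with h' | h'
      · exact Or.inl (hτ' x _ (isOutgoing_rel_iff.1 h')).symm
      · exact Or.inr (hτ' y _ (isIncoming_rel_iff.1 h')).symm
    rintro ⟨i, b⟩ x y hxy
    cases b
    · exact (key i y x (by simpa [signedRel] using hxy)).symm
    · exact key i x y (by simpa [signedRel] using hxy)
  · rintro ⟨hf, hn, τ, h⟩
    have hs : ∀ x R, ∃ y, A.signedRel R x y := by
      intro x R
      by_cases hR : R = τ x
      · obtain ⟨z, w, -, hz, -⟩ := h.branch x
        exact ⟨z, hR ▸ hz⟩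
      · exact (h.unique x R hR).exists
    refine ⟨hf, hn, ?_, ?_, ?_⟩
    · intro i a
      exact ⟨by simpa [signedRel] using hs a (i, true), by simpa [signedRel] using hs a (i, false)⟩
    · intro x
      simp only [h.isOutgoing_iff]
      exact ⟨⟨τ x, rfl, fun R hR => hR.symm⟩, fun R hR => h.unique x R (Ne.symm hR)⟩
    · intro i x y hxy
      rw [isOutgoing_rel_iff, isIncoming_rel_iff, h.isOutgoing_iff, h.isOutgoing_iff]
      exact h.edge (i, true) x y (by simpa [signedRel] using hxy)

theorem AmpleFamily.finSurj {A : TopStr.{0} m} (h : AmpleFamily m A) : FinSurj A where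
  finite := h.finite
  nonempty := h.nonempty
  surj := by
    rintro ⟨i, b⟩ x
    cases b
    · simpa [signedRel] using (h.surjRel i x).2
    · simpa [signedRel] using (h.surjRel i x).1

theorem AmpleFamily.of_equiv {A B : TopStr.{0} m} (hA : AmpleFamily m A) (e : B ≃ A)
    (he : ∀ i x y, B.rel i x y ↔ A.rel i (e x) (e y)) : AmpleFamily m B := by
  obtain ⟨hf, ⟨a⟩, τ, h⟩ := ampleFamily_iff.1 hA
  have he' : ∀ R x y, B.signedRel R x y ↔ A.signedRel R (e x) (e y) :=
    signedRel_of_forall (E := fun R x y => A.signedRel R (e x) (e y))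
      (fun R x y => A.signedRel_invSign R _ _) (fun i x y => by simp [signedRel, he])
  refine ampleFamily_iff.2 ⟨Finite.of_equiv _ e.symm, ⟨e.symm a⟩, τ ∘ e, ?_, ?_, ?_⟩
  · intro x R hR
    obtain ⟨y, hy, hy'⟩ := h.unique (e x) R hR
    refine ⟨e.symm y, by simpa [he'] using hy, fun z hz => ?_⟩
    rw [← hy' (e z) ((he' _ _ _).1 hz), e.symm_apply_apply]
  · intro x
    obtain ⟨z, w, hzw, hz, hw⟩ := h.branch (e x)
    exact ⟨e.symm z, e.symm w, by simpa using hzw, by simpa [he'] using hz,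
      by simpa [he'] using hw⟩
  · intro R x y hxy
    exact h.edge R _ _ ((he' _ _ _).1 hxy)

/-! ### Covering surjective structures by members of the family -/

section Cover

variable (A : TopStr.{0} m) (σ₀ : A → Fin m × Bool → A)

/-- A point of `A`, a choice of a neighbour for each signed relation, a direction, and a bit. -/
@[ext] structure StarPoint where
  pt : A
  nbr : Fin m × Bool → A
  dir : Fin m × Bool
  bit : Bool
  nbr_rel : ∀ R, A.signedRel R pt (nbr R)

variable {A}

theorem finite_starPoint [Finite A] : Finite (StarPoint A) :=
  Finite.of_injective (fun p : StarPoint A => (p.pt, p.nbr, p.dir, p.bit)) fun p q h => by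
    simp only [Prod.mk.injEq] at h
    exact StarPoint.ext h.1 h.2.1 h.2.2.1 h.2.2.2

open Classical in
/-- The star at the origin of an edge `R a b`, directed along that edge, which uses the default
neighbours `σ₀ a` for the other signed relations. -/
def StarPoint.base (hσ : ∀ a R, A.signedRel R a (σ₀ a R)) (R : Fin m × Bool) (a b : A)
    (h : A.signedRel R a b) (c : Bool) : StarPoint A where
  pt := a
  nbr := Function.update (σ₀ a) R b
  dir := R
  bit := c
  nbr_rel S := by
    by_cases hS : S = R
    · subst hS; simpa using h
    · simpa [Function.update_of_ne hS] using hσ a S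

variable (hσ : ∀ a R, A.signedRel R a (σ₀ a R))

theorem StarPoint.base_congr {R S : Fin m × Bool} (h : R = S) {a b : A} (hR : A.signedRel R a b)
    (hS : A.signedRel S a b) {c : Bool} :
    base σ₀ hσ R a b hR c = base σ₀ hσ S a b hS c := by
  subst h; rfl

/-- Two stars are joined along `R` if they agree about the edge of `A` joining their centres and,
whenever one of them does not point along that edge, the other one is the base star of the edge. -/
def StarPoint.Joined (R : Fin m × Bool) (p q : StarPoint A) : Prop :=
  ∃ (h : p.nbr R = q.pt) (h' : q.nbr (invSign R) = p.pt),
    (q.dir ≠ invSign R → p = base σ₀ hσ R p.pt q.pt (h ▸ p.nbr_rel R) true) ∧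
    (p.dir ≠ R → q = base σ₀ hσ (invSign R) q.pt p.pt (h' ▸ q.nbr_rel (invSign R)) true)

theorem StarPoint.joined_invSign (R : Fin m × Bool) (p q : StarPoint A) :
    Joined σ₀ hσ (invSign R) p q ↔ Joined σ₀ hσ R q p := by
  have key : ∀ R (p q : StarPoint A), Joined σ₀ hσ R q p → Joined σ₀ hσ (invSign R) p q := by
    rintro R p q ⟨h, h', h1, h2⟩
    exact ⟨h', by simpa using h, fun hd => h2 (by simpa using hd),
      fun hd => (h1 hd).trans (base_congr σ₀ hσ (invSign_invSign R).symm _ _)⟩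
  exact ⟨fun h => by simpa using key _ _ _ h, key _ _ _⟩

theorem StarPoint.joined_base (R : Fin m × Bool) (p : StarPoint A) (c : Bool)
    (hc : p.dir ≠ R → c = true) :
    Joined σ₀ hσ R p (base σ₀ hσ (invSign R) (p.nbr R) p.pt
      ((A.signedRel_invSign _ _ _).2 (p.nbr_rel R)) c) := by
  refine ⟨rfl, by simp [base], fun h => (h rfl).elim, fun h => ?_⟩
  obtain rfl := hc h
  rfl

/-- The structure of stars. -/
def starStr [Finite A] : TopStr.{0} m :=
  haveI := finite_starPoint (A := A)
  ofFinite (StarPoint A) fun i => StarPoint.Joined σ₀ hσ (i, true)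

theorem starStr_signedRel [Finite A] (R : Fin m × Bool) (p q : StarPoint A) :
    (starStr σ₀ hσ).signedRel R p q ↔ StarPoint.Joined σ₀ hσ R p q :=
  signedRel_of_forall (A := starStr σ₀ hσ) (E := StarPoint.Joined σ₀ hσ)
    (StarPoint.joined_invSign σ₀ hσ) (fun _ _ _ => Iff.rfl) R p q

theorem isDirection_starStr [Finite A] :
    IsDirection (starStr σ₀ hσ) (StarPoint.dir : StarPoint A → _) where
  unique (p : StarPoint A) R hR := by
    refine ⟨_, (starStr_signedRel σ₀ hσ R p _).2
      (StarPoint.joined_base σ₀ hσ R p true fun _ => rfl), fun (q : StarPoint A) hq => ?_⟩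
    obtain ⟨h, h', -, h2⟩ := (starStr_signedRel σ₀ hσ R p q).1 hq
    rw [h2 hR.symm]
    congr 1
    exact h.symm
  branch (p : StarPoint A) := by
    refine ⟨_, _, ?_, (starStr_signedRel σ₀ hσ p.dir p _).2
      (StarPoint.joined_base σ₀ hσ p.dir p true fun h => (h rfl).elim),
      (starStr_signedRel σ₀ hσ p.dir p _).2
      (StarPoint.joined_base σ₀ hσ p.dir p false fun h => (h rfl).elim)⟩
    intro h
    simpa [StarPoint.base] using congrArg StarPoint.bit h
  edge R (p : StarPoint A) (q : StarPoint A) hpq := by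
    obtain ⟨h, h', h1, h2⟩ := (starStr_signedRel σ₀ hσ R p q).1 hpq
    by_contra! hne
    have := congrArg StarPoint.dir (h1 hne.2)
    exact hne.1 this

end Cover

/-- Every finite structure with surjective relations is covered by a member of the family in such
a way that all neighbours of a point along one signed relation have the same image. -/
theorem TopStr.FinSurj.exists_cover (hm : 1 ≤ m) {A : TopStr.{0} m} (hA : FinSurj A) :
    ∃ B : TopStr.{0} m, AmpleFamily m B ∧ ∃ π : B → A, IsEpi B A π ∧
      ∀ R x y z, B.signedRel R x y → B.signedRel R x z → π y = π z := by
  have := hA.finite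
  choose σ₀ hσ using fun a R => hA.surj R a
  let R₀ : Fin m × Bool := (⟨0, hm⟩, true)
  let p : A → StarPoint A := fun a => ⟨a, σ₀ a, R₀, true, hσ a⟩
  have hfin : Finite (starStr σ₀ hσ) := finite_starPoint (A := A)
  refine ⟨starStr σ₀ hσ, ampleFamily_iff.2 ⟨hfin, ?_, _, isDirection_starStr σ₀ hσ⟩,
    (StarPoint.pt : StarPoint A → A),
    ⟨continuous_of_finite (A := starStr σ₀ hσ) _, fun a => ⟨p a, rfl⟩, ?_⟩, ?_⟩
  · obtain ⟨a⟩ := hA.nonempty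
    exact ⟨p a⟩
  · intro i a b
    constructor
    · intro h
      let q := StarPoint.base σ₀ hσ (i, true) a b (by simpa [signedRel] using h) true
      exact ⟨q, _, rfl, by simp [q, StarPoint.base],
        StarPoint.joined_base σ₀ hσ (i, true) q true fun _ => rfl⟩
    · rintro ⟨p, q, rfl, rfl, h, -⟩
      have := p.nbr_rel (i, true)
      rw [h] at this
      simpa [signedRel] using this
  · intro R (x : StarPoint A) (y : StarPoint A) (z : StarPoint A) hy hz
    obtain ⟨h, -⟩ := (starStr_signedRel σ₀ hσ R x y).1 hy
    obtain ⟨h', -⟩ := (starStr_signedRel σ₀ hσ R x z).1 hz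
    exact h.symm.trans h'

/-! ### Joint projection and amalgamation -/

theorem exists_forall_of_antitone {K : Type*} [Finite K] {p : ℕ → K → Prop}
    (hp : ∀ n z, p (n + 1) z → p n z) (h : ∀ n, ∃ z, p n z) : ∃ z, ∀ n, p n z := by
  by_contra! hne
  choose N hN using hne
  obtain ⟨M, hM⟩ := (Set.finite_range N).bddAbove
  obtain ⟨z, hz⟩ := h M
  exact hN z (antitone_nat_of_succ_le (f := fun n => p n z) (fun n => hp n z)
    (hM ⟨z, rfl⟩) hz)

/-- A common cover of two finite structures by one with surjective relations. -/
theorem TopStr.FinSurj.exists_joint {A B : TopStr.{0} m} (hA : FinSurj A) (hB : FinSurj B) :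
    ∃ C, FinSurj C ∧ (∃ φ : C → A, IsEpi C A φ) ∧ ∃ ψ : C → B, IsEpi C B ψ := by
  have := hA.finite
  have := hB.finite
  let C : TopStr.{0} m := ofFinite (A × B) fun i p q => A.rel i p.1 q.1 ∧ B.rel i p.2 q.2
  have hC : ∀ R (p q : A × B), C.signedRel R p q ↔
      A.signedRel R p.1 q.1 ∧ B.signedRel R p.2 q.2 :=
    signedRel_of_forall (A := C)
      (E := fun R (p q : A × B) => A.signedRel R p.1 q.1 ∧ B.signedRel R p.2 q.2)
      (fun R p q => and_congr (A.signedRel_invSign _ _ _) (B.signedRel_invSign _ _ _))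
      (fun _ _ _ => Iff.rfl)
  have hfin : Finite C := inferInstanceAs (Finite (A × B))
  obtain ⟨a₀⟩ := hA.nonempty
  obtain ⟨b₀⟩ := hB.nonempty
  refine ⟨C, ⟨hfin, ⟨(a₀, b₀)⟩, fun R p => ?_⟩,
    ⟨(Prod.fst : A × B → A), continuous_of_finite (A := C) _, fun a => ⟨(a, b₀), rfl⟩, ?_⟩,
    ⟨(Prod.snd : A × B → B), continuous_of_finite (A := C) _, fun b => ⟨(a₀, b), rfl⟩, ?_⟩⟩
  · obtain ⟨a, ha⟩ := hA.surj R p.1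
    obtain ⟨b, hb⟩ := hB.surj R p.2
    exact ⟨(a, b), (hC R p (a, b)).2 ⟨ha, hb⟩⟩
  · intro i x y
    constructor
    · intro h
      obtain ⟨b, hb⟩ := hB.surj (i, true) b₀
      exact ⟨(x, b₀), (y, b), rfl, rfl, h, by simpa [signedRel] using hb⟩
    · rintro ⟨p, q, rfl, rfl, h⟩
      exact h.1
  · intro i x y
    constructor
    · intro h
      obtain ⟨a, ha⟩ := hA.surj (i, true) a₀
      exact ⟨(a₀, x), (a, y), rfl, rfl, by simpa [signedRel] using ha, h⟩
    · rintro ⟨p, q, rfl, rfl, h⟩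
      exact h.2

section Amalgamation

variable {A B₁ B₂ : TopStr.{0} m} (τ : A → Fin m × Bool) (φ₁ : B₁ → A) (φ₂ : B₂ → A)

/-- The pairs of points with the same image in `A` from which one can take `n` simultaneous steps,
each along the direction of the current common image. -/
def Threaded : ℕ → B₁ → B₂ → Prop
  | 0, x, y => φ₁ x = φ₂ y
  | n + 1, x, y => φ₁ x = φ₂ y ∧ ∃ x' y', B₁.signedRel (τ (φ₁ x)) x x' ∧
      B₂.signedRel (τ (φ₁ x)) y y' ∧ Threaded n x' y'

variable {τ φ₁ φ₂}

theorem Threaded.of_succ {n : ℕ} {x : B₁} {y : B₂} (h : Threaded τ φ₁ φ₂ (n + 1) x y) :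
    Threaded τ φ₁ φ₂ n x y := by
  induction n generalizing x y with
  | zero => exact h.1
  | succ n ih =>
    obtain ⟨h, x', y', hx, hy, h'⟩ := h
    exact ⟨h, x', y', hx, hy, ih h'⟩

theorem Threaded.swap {n : ℕ} {x : B₁} {y : B₂} (h : Threaded τ φ₁ φ₂ n x y) :
    Threaded τ φ₂ φ₁ n y x := by
  induction n generalizing x y with
  | zero => exact h.symm
  | succ n ih =>
    obtain ⟨h, x', y', hx, hy, h'⟩ := h
    exact ⟨h.symm, y', x', h ▸ hy, h ▸ hx, ih h'⟩

/-- Two pairs which are joined along the directions of both of their images can be threaded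
forever, by going back and forth. -/
theorem threaded_of_mutual {Q : Fin m × Bool} {x x' : B₁} {y y' : B₂} (hx : B₁.signedRel Q x x')
    (hy : B₂.signedRel Q y y') (h : φ₁ x = φ₂ y) (h' : φ₁ x' = φ₂ y') (hQ : τ (φ₁ x) = Q)
    (hQ' : τ (φ₁ x') = invSign Q) (n : ℕ) :
    Threaded τ φ₁ φ₂ n x y ∧ Threaded τ φ₁ φ₂ n x' y' := by
  induction n with
  | zero => exact ⟨h, h'⟩
  | succ n ih =>
    refine ⟨⟨h, x', y', ?_, ?_, ih.2⟩, ⟨h', x, y, ?_, ?_, ih.1⟩⟩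
    · rwa [hQ]
    · rwa [hQ]
    · rwa [hQ', signedRel_invSign]
    · rwa [hQ', signedRel_invSign]

/-- An edge along the direction of the image of its origin lifts. The lift is found by following
the directions for `n` steps, lifting the last edge, and coming back, which away from the direction
can be done in only one way in `A`. -/
theorem exists_threaded_lift (hτ : IsDirection A τ) (h₁ : FinSurj B₁) (h₂ : FinSurj B₂)
    (hφ₁ : IsEpi B₁ A φ₁) (hφ₂ : IsEpi B₂ A φ₂) (n : ℕ) {x x' : B₁}
    (hx : B₁.signedRel (τ (φ₁ x)) x x') :
    ∃ y y', φ₁ x = φ₂ y ∧ B₂.signedRel (τ (φ₁ x)) y y' ∧ Threaded τ φ₁ φ₂ n x' y' := by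
  induction n generalizing x x' with
  | zero =>
    obtain ⟨y, y', hy, hy', hr⟩ := (hφ₂.signedRel_iff _ _ _).1 (hφ₁.map hx)
    exact ⟨y, y', hy.symm, hr, hy'.symm⟩
  | succ n ih =>
    by_cases hmut : τ (φ₁ x') = invSign (τ (φ₁ x))
    · obtain ⟨y, y', hy, hy', hr⟩ := (hφ₂.signedRel_iff _ _ _).1 (hφ₁.map hx)
      exact ⟨y, y', hy.symm, hr, (threaded_of_mutual hx hr hy.symm hy'.symm rfl hmut _).2⟩
    · obtain ⟨x'', hx''⟩ := h₁.surj (τ (φ₁ x')) x'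
      obtain ⟨y', y'', hy', hr', ht⟩ := ih hx''
      obtain ⟨y, hy⟩ := h₂.exists_pred (τ (φ₁ x)) y'
      have hu := hτ.unique (φ₁ x') _ (Ne.symm hmut)
      refine ⟨y, y', hu.unique ?_ ?_, hy, ⟨hy', x'', y'', hx'', hr', ht⟩⟩
      · rw [signedRel_invSign]
        exact hφ₁.map hx
      · rw [signedRel_invSign, hy']
        exact hφ₂.map hy

/-- Every edge of `B₁` lifts to an edge between pairs which can be threaded forever. -/
theorem exists_forall_threaded_lift (hτ : IsDirection A τ) (h₁ : FinSurj B₁) (h₂ : FinSurj B₂)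
    (hφ₁ : IsEpi B₁ A φ₁) (hφ₂ : IsEpi B₂ A φ₂) {Q : Fin m × Bool} {x x' : B₁}
    (hx : B₁.signedRel Q x x') :
    ∃ y y', B₂.signedRel Q y y' ∧ (∀ n, Threaded τ φ₁ φ₂ n x y) ∧
      ∀ n, Threaded τ φ₁ φ₂ n x' y' := by
  have := h₂.finite
  have key : ∀ {Q : Fin m × Bool} {x x' : B₁}, B₁.signedRel Q x x' → τ (φ₁ x) = Q →
      ∃ y y', B₂.signedRel Q y y' ∧ (∀ n, Threaded τ φ₁ φ₂ n x y) ∧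
      ∀ n, Threaded τ φ₁ φ₂ n x' y' := by
    rintro Q x x' hx rfl
    obtain ⟨⟨y, y'⟩, h⟩ := exists_forall_of_antitone (K := B₂ × B₂)
      (p := fun n z => φ₁ x = φ₂ z.1 ∧ B₂.signedRel (τ (φ₁ x)) z.1 z.2 ∧
        Threaded τ φ₁ φ₂ n x' z.2)
      (fun n z h => ⟨h.1, h.2.1, h.2.2.of_succ⟩)
      (fun n => by
        obtain ⟨y, y', h⟩ := exists_threaded_lift hτ h₁ h₂ hφ₁ hφ₂ n hx
        exact ⟨(y, y'), h⟩)
    exact ⟨y, y', (h 0).2.1,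
      fun n => Threaded.of_succ ⟨(h 0).1, x', y', hx, (h 0).2.1, (h n).2.2⟩, fun n => (h n).2.2⟩
  rcases hτ.edge Q _ _ (hφ₁.map hx) with h | h
  · exact key hx h
  · obtain ⟨y', y, hy, ht', ht⟩ := key ((B₁.signedRel_invSign Q x' x).2 hx) h
    exact ⟨y, y', (B₂.signedRel_invSign Q y' y).1 hy, ht, ht'⟩

/-- The pairs which can be threaded forever have neighbours of the same kind along every signed
relation. -/
theorem exists_threaded_succ (hτ : IsDirection A τ) (h₁ : FinSurj B₁) (h₂ : FinSurj B₂)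
    (hφ₁ : IsEpi B₁ A φ₁) (hφ₂ : IsEpi B₂ A φ₂) {x : B₁} {y : B₂}
    (h : ∀ n, Threaded τ φ₁ φ₂ n x y) (Q : Fin m × Bool) :
    ∃ x' y', B₁.signedRel Q x x' ∧ B₂.signedRel Q y y' ∧ ∀ n, Threaded τ φ₁ φ₂ n x' y' := by
  have := h₁.finite
  have := h₂.finite
  have h0 : φ₁ x = φ₂ y := h 0
  by_cases hQ : Q = τ (φ₁ x)
  · subst hQ
    obtain ⟨⟨x', y'⟩, h'⟩ := exists_forall_of_antitone (K := B₁ × B₂)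
      (p := fun n z => B₁.signedRel (τ (φ₁ x)) x z.1 ∧ B₂.signedRel (τ (φ₁ x)) y z.2 ∧
        Threaded τ φ₁ φ₂ n z.1 z.2)
      (fun n z h => ⟨h.1, h.2.1, h.2.2.of_succ⟩)
      (fun n => by
        obtain ⟨-, x', y', h⟩ := h (n + 1)
        exact ⟨(x', y'), h⟩)
    exact ⟨x', y', (h' 0).1, (h' 0).2.1, fun n => (h' n).2.2⟩
  · -- Away from the direction the neighbour in `A` is unique and points back.
    obtain ⟨x', hx'⟩ := h₁.surj Q x
    obtain ⟨y', hy'⟩ := h₂.surj Q y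
    have h1 := hφ₁.map hx'
    have h' : φ₁ x' = φ₂ y' := (hτ.unique _ Q hQ).unique h1 (h0 ▸ hφ₂.map hy')
    have hd : τ (φ₁ x') = invSign Q := (hτ.edge Q _ _ h1).resolve_left (Ne.symm hQ)
    refine ⟨x', y', hx', hy', fun n => Threaded.of_succ ⟨h', x, y, ?_, ?_, h n⟩⟩
    · rwa [hd, signedRel_invSign]
    · rwa [hd, signedRel_invSign]

/-- Amalgamation over a member of the family, within finite structures with surjective
relations. -/
theorem TopStr.FinSurj.exists_amalgam (hτ : IsDirection A τ) (h₁ : FinSurj B₁) (h₂ : FinSurj B₂)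
    (hφ₁ : IsEpi B₁ A φ₁) (hφ₂ : IsEpi B₂ A φ₂) :
    ∃ C, FinSurj C ∧ ∃ (φ₃ : C → B₁) (φ₄ : C → B₂),
      IsEpi C B₁ φ₃ ∧ IsEpi C B₂ φ₄ ∧ φ₁ ∘ φ₃ = φ₂ ∘ φ₄ := by
  have := h₁.finite
  have := h₂.finite
  let K := {p : B₁ × B₂ // ∀ n, Threaded τ φ₁ φ₂ n p.1 p.2}
  let C : TopStr.{0} m := ofFinite K fun i p q => B₁.rel i p.1.1 q.1.1 ∧ B₂.rel i p.1.2 q.1.2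
  have hC : ∀ R (p q : K), C.signedRel R p q ↔
      B₁.signedRel R p.1.1 q.1.1 ∧ B₂.signedRel R p.1.2 q.1.2 :=
    signedRel_of_forall (A := C)
      (E := fun R (p q : K) => B₁.signedRel R p.1.1 q.1.1 ∧ B₂.signedRel R p.1.2 q.1.2)
      (fun R p q => and_congr (B₁.signedRel_invSign _ _ _) (B₂.signedRel_invSign _ _ _))
      (fun _ _ _ => Iff.rfl)
  have hfin : Finite C := inferInstanceAs (Finite K)
  have hsurj : ∀ R (p : K), ∃ q : K, C.signedRel R p q := by
    intro R p
    obtain ⟨x', y', hx, hy, h⟩ := exists_threaded_succ hτ h₁ h₂ hφ₁ hφ₂ p.2 R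
    exact ⟨⟨(x', y'), h⟩, (hC R p _).2 ⟨hx, hy⟩⟩
  have hl : ∀ {i x x'}, B₁.rel i x x' → ∃ p q : K, p.1.1 = x ∧ q.1.1 = x' ∧ C.rel i p q := by
    intro i x x' hx
    obtain ⟨y, y', hy, h, h'⟩ := exists_forall_threaded_lift hτ h₁ h₂ hφ₁ hφ₂
      (Q := (i, true)) (x := x) (x' := x') (by simpa [signedRel] using hx)
    exact ⟨⟨(x, y), h⟩, ⟨(x', y'), h'⟩, rfl, rfl, hx, by simpa [signedRel] using hy⟩
  have hr : ∀ {i y y'}, B₂.rel i y y' → ∃ p q : K, p.1.2 = y ∧ q.1.2 = y' ∧ C.rel i p q := by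
    intro i y y' hy
    obtain ⟨x, x', hx, h, h'⟩ := exists_forall_threaded_lift hτ h₂ h₁ hφ₂ hφ₁
      (Q := (i, true)) (x := y) (x' := y') (by simpa [signedRel] using hy)
    exact ⟨⟨(x, y), fun n => (h n).swap⟩, ⟨(x', y'), fun n => (h' n).swap⟩, rfl, rfl,
      by simpa [signedRel] using hx, hy⟩
  have hpt₁ : ∀ x : B₁, ∃ p : K, p.1.1 = x := fun x => by
    obtain ⟨x', hx'⟩ := h₁.surj (τ (φ₁ x)) x
    obtain ⟨y, y', -, h, -⟩ := exists_forall_threaded_lift hτ h₁ h₂ hφ₁ hφ₂ hx'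
    exact ⟨⟨(x, y), h⟩, rfl⟩
  have hpt₂ : ∀ y : B₂, ∃ p : K, p.1.2 = y := fun y => by
    obtain ⟨y', hy'⟩ := h₂.surj (τ (φ₂ y)) y
    obtain ⟨x, x', -, h, -⟩ := exists_forall_threaded_lift hτ h₂ h₁ hφ₂ hφ₁ hy'
    exact ⟨⟨(x, y), fun n => (h n).swap⟩, rfl⟩
  refine ⟨C, ⟨hfin, ?_, hsurj⟩, (fun p : K => p.1.1), (fun p : K => p.1.2),
    ⟨continuous_of_finite (A := C) _, hpt₁, fun i x x' => ⟨hl, ?_⟩⟩,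
    ⟨continuous_of_finite (A := C) _, hpt₂, fun i y y' => ⟨hr, ?_⟩⟩,
    funext fun p : K => p.2 0⟩
  · obtain ⟨x⟩ := h₁.nonempty
    exact ⟨(hpt₁ x).choose⟩
  · rintro ⟨p, q, rfl, rfl, h⟩
    exact h.1
  · rintro ⟨p, q, rfl, rfl, h⟩
    exact h.2

end Amalgamation

theorem isProjFraisseFamily_ampleFamily (hm : 1 ≤ m) : IsProjFraisseFamily (AmpleFamily m) where
  finite A hA := hA.finite
  jpp A B hA hB := by
    obtain ⟨C, hC, ⟨φ, hφ⟩, ψ, hψ⟩ := hA.finSurj.exists_joint hB.finSurj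
    obtain ⟨D, hD, π, hπ, -⟩ := hC.exists_cover hm
    exact ⟨D, hD, ⟨_, hφ.comp hπ⟩, _, hψ.comp hπ⟩
  ap A B₁ B₂ hA h₁ h₂ φ₁ φ₂ hφ₁ hφ₂ := by
    obtain ⟨-, -, τ, hτ⟩ := ampleFamily_iff.1 hA
    obtain ⟨C, hC, φ₃, φ₄, h₃, h₄, h⟩ := FinSurj.exists_amalgam hτ h₁.finSurj h₂.finSurj hφ₁ hφ₂
    obtain ⟨D, hD, π, hπ, -⟩ := hC.exists_cover hm
    refine ⟨D, hD, _, _, h₃.comp hπ, h₄.comp hπ, ?_⟩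
    rw [← Function.comp_assoc, h, Function.comp_assoc]

theorem exists_ampleFamily (hm : 1 ≤ m) : ∃ A, AmpleFamily m A := by
  obtain ⟨A, hA, -⟩ := FinSurj.exists_cover (A := ofFinite Unit fun _ _ _ => True) hm
    ⟨inferInstanceAs (Finite Unit), ⟨()⟩, fun R x => ⟨x, by simp [signedRel, ofFinite]⟩⟩
  exact ⟨A, hA⟩

/-! ### Back and forth between limits -/

/-- Continuous maps to finite discrete spaces factor through epimorphisms onto members. -/
def HasFactors (𝓕 : TopStr.{0} m → Prop) (L : TopStr.{u} m) : Prop :=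
  ∀ (X : Type) [Finite X] [TopologicalSpace X] [DiscreteTopology X] (f : L → X),
    Continuous f → ∃ A, 𝓕 A ∧ ∃ (φ : L → A) (f₀ : A → X), IsEpi L A φ ∧ f = f₀ ∘ φ

/-- The extension property: epimorphisms onto members lift through epimorphisms between members. -/
def HasExtensions (𝓕 : TopStr.{0} m → Prop) (L : TopStr.{u} m) : Prop :=
  ∀ A B, 𝓕 A → 𝓕 B → ∀ (φ : L → A) (α : B → A), IsEpi L A φ → IsEpi B A α →
    ∃ β : L → B, IsEpi L B β ∧ α ∘ β = φ

theorem eq_of_forall_clopens {X : Type u} [TopologicalSpace X] [CompactSpace X] [T2Space X]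
    [TotallyDisconnectedSpace X] {x y : X} (h : ∀ U : Clopens X, x ∈ U → y ∈ U) : x = y := by
  by_contra hne
  obtain ⟨V, hV, hx, hy⟩ := exists_isClopen_of_totally_separated hne
  exact hy (h ⟨V, hV⟩ hx)

theorem exists_clopens_enum (X : Type u) [TopologicalSpace X] [CompactSpace X] [T2Space X]
    [TotallyDisconnectedSpace X] [SecondCountableTopology X] :
    ∃ U : ℕ → Clopens X, Function.Surjective U :=
  have := Clopens.countable_iff_secondCountable.2 ‹SecondCountableTopology X›
  exists_surjective_nat _

/-- Cantor's intersection theorem for a decreasing sequence of closed conditions. -/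
theorem exists_forall_of_isClosed {X : Type u} [TopologicalSpace X] [CompactSpace X]
    {p : ℕ → X → Prop} (hp : ∀ n x, p (n + 1) x → p n x) (hc : ∀ n, IsClosed {x | p n x})
    (h : ∀ n, ∃ x, p n x) : ∃ x, ∀ n, p n x := by
  obtain ⟨x, hx⟩ := IsCompact.nonempty_iInter_of_sequence_nonempty_isCompact_isClosed
    (fun n => {x | p n x}) (fun n x => hp n x) h (hc 0).isCompact hc
  exact ⟨x, fun n => Set.mem_iInter.1 hx n⟩

/-- A structure approximated by finer and finer finite quotients which separate points: its
relations are determined by those of the quotients. -/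
theorem rel_iff_forall {L : TopStr.{u} m} {A : ℕ → TopStr.{v} m} {φ : ∀ n, L → A n}
    (hφ : ∀ n, IsEpi L (A n) (φ n)) (hn : ∀ n x y, φ (n + 1) x = φ (n + 1) y → φ n x = φ n y)
    (hs : ∀ x y, (∀ n, φ n x = φ n y) → x = y) (i : Fin m) (x y : L) :
    L.rel i x y ↔ ∀ n, (A n).rel i (φ n x) (φ n y) := by
  refine ⟨fun h n => ((hφ n).rel_iff _ _ _).2 ⟨x, y, rfl, rfl, h⟩, fun h => ?_⟩
  obtain ⟨p, hp⟩ := exists_forall_of_isClosed (X := L × L)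
    (p := fun n p => L.rel i p.1 p.2 ∧ φ n p.1 = φ n x ∧ φ n p.2 = φ n y)
    (fun n p h => ⟨h.1, hn n _ _ h.2.1, hn n _ _ h.2.2⟩)
    (fun n => (L.isClosed_rel i).inter
      ((isClosed_eq ((hφ n).continuous.comp continuous_fst) continuous_const).inter
        (isClosed_eq ((hφ n).continuous.comp continuous_snd) continuous_const)))
    (fun n => by
      obtain ⟨x', y', hx, hy, hr⟩ := ((hφ n).rel_iff _ _ _).1 (h n)
      exact ⟨(x', y'), hr, hx, hy⟩)
  rw [← hs p.1 x fun n => (hp n).2.1, ← hs p.2 y fun n => (hp n).2.2]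
  exact (hp 0).1

section BackAndForth

variable {𝓕 : TopStr.{0} m → Prop} {L : TopStr.{u} m} {L' : TopStr.{v} m}

/-- A common finite quotient of two structures. -/
structure CommonQuotient (𝓕 : TopStr.{0} m → Prop) (L : TopStr.{u} m) (L' : TopStr.{v} m) where
  str : TopStr.{0} m
  mem : 𝓕 str
  left : L → str
  right : L' → str
  isEpi_left : IsEpi L str left
  isEpi_right : IsEpi L' str right

/-- `t` refines `s`, compatibly with both quotient maps. -/
def CommonQuotient.Refines (t s : CommonQuotient 𝓕 L L') : Prop :=
  ∃ α : t.str → s.str, α ∘ t.left = s.left ∧ α ∘ t.right = s.right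

theorem CommonQuotient.Refines.trans {r s t : CommonQuotient 𝓕 L L'} (h : t.Refines s)
    (h' : s.Refines r) : t.Refines r := by
  obtain ⟨α, h1, h2⟩ := h
  obtain ⟨β, h3, h4⟩ := h'
  exact ⟨β ∘ α, by rw [Function.comp_assoc, h1, h3], by rw [Function.comp_assoc, h2, h4]⟩

/-- Exchange the roles of the two structures. -/
def CommonQuotient.symm (s : CommonQuotient 𝓕 L L') : CommonQuotient 𝓕 L' L :=
  ⟨s.str, s.mem, s.right, s.left, s.isEpi_right, s.isEpi_left⟩

theorem CommonQuotient.exists_refines_left (hfin : ∀ A, 𝓕 A → Finite A) (hL : HasFactors 𝓕 L)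
    (hL' : HasExtensions 𝓕 L') (s : CommonQuotient 𝓕 L L') (U : Clopens L) :
    ∃ t : CommonQuotient 𝓕 L L', t.Refines s ∧ ∀ x y, t.left x = t.left y → x ∈ U → y ∈ U := by
  have := hfin _ s.mem
  obtain ⟨B, hB, ρ, f₀, hρ, hf⟩ := hL (s.str × Bool)
    (fun x => (s.left x, (U : Set L).boolIndicator x)) (s.isEpi_left.continuous.prodMk
      ((continuous_boolIndicator_iff_isClopen _).2 U.isClopen))
  have := hfin _ hB
  have h1 : (Prod.fst ∘ f₀) ∘ ρ = s.left := by
    rw [Function.comp_assoc, ← hf]; rfl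
  obtain ⟨β, hβ, hβ'⟩ := hL' s.str B s.mem hB s.right (Prod.fst ∘ f₀) s.isEpi_right
    (IsEpi.of_comp (h1 ▸ s.isEpi_left) hρ)
  refine ⟨⟨B, hB, ρ, β, hρ, hβ⟩, ⟨_, h1, hβ'⟩, fun x y (hxy : ρ x = ρ y) hx => ?_⟩
  have h2 := congrArg (fun z => (f₀ z).2) hxy
  have h3 := fun x => congrArg Prod.snd (congrFun hf x)
  simp only [Function.comp_apply] at h3
  rw [← h3 x, ← h3 y, (Set.mem_iff_boolIndicator (U : Set L) x).1 hx] at h2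
  exact (Set.mem_iff_boolIndicator (U : Set L) y).2 h2.symm

theorem CommonQuotient.exists_refines (hfin : ∀ A, 𝓕 A → Finite A) (hL : HasFactors 𝓕 L)
    (hL' : HasFactors 𝓕 L') (hE : HasExtensions 𝓕 L) (hE' : HasExtensions 𝓕 L')
    (s : CommonQuotient 𝓕 L L') (U : Clopens L) (V : Clopens L') :
    ∃ t : CommonQuotient 𝓕 L L', t.Refines s ∧ (∀ x y, t.left x = t.left y → x ∈ U → y ∈ U) ∧
      ∀ x y, t.right x = t.right y → x ∈ V → y ∈ V := by
  obtain ⟨t, ht, hU⟩ := s.exists_refines_left hfin hL hE' U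
  obtain ⟨r, ⟨α, h1, h2⟩, hV⟩ := t.symm.exists_refines_left hfin hL' hE V
  refine ⟨r.symm, CommonQuotient.Refines.trans ⟨α, h2, h1⟩ ht, fun x y hxy => hU x y ?_, hV⟩
  have h3 : ∀ x, α (r.right x) = t.left x := congrFun h2
  rw [← h3, ← h3]
  exact congrArg α hxy

/-- Two structures with the factorization and extension properties for the same family are
isomorphic over any common quotient in the family. -/
theorem exists_isIso_of_hasExtensions (hfin : ∀ A, 𝓕 A → Finite A) (hL : HasFactors 𝓕 L)
    (hL' : HasFactors 𝓕 L') (hE : HasExtensions 𝓕 L) (hE' : HasExtensions 𝓕 L')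
    {A : TopStr.{0} m} (hA : 𝓕 A) {φ : L → A} {φ' : L' → A} (hφ : IsEpi L A φ)
    (hφ' : IsEpi L' A φ') : ∃ ψ : L → L', IsIso L L' ψ ∧ φ' ∘ ψ = φ := by
  obtain ⟨U, hU⟩ := exists_clopens_enum L
  obtain ⟨V, hV⟩ := exists_clopens_enum L'
  choose! next hnext hnextU hnextV using fun (s : CommonQuotient 𝓕 L L') n =>
    s.exists_refines hfin hL hL' hE hE' (U n) (V n)
  let s : ℕ → CommonQuotient 𝓕 L L' := fun n =>
    Nat.rec ⟨A, hA, φ, φ', hφ, hφ'⟩ (fun n s => next s n) n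
  have hr : ∀ n, (s (n + 1)).Refines (s n) := fun n => hnext (s n) n
  have hl : ∀ n x y, (s (n + 1)).left x = (s (n + 1)).left y → (s n).left x = (s n).left y := by
    intro n x y h
    obtain ⟨α, h1, -⟩ := hr n
    simpa [← h1] using congrArg α h
  have hrt : ∀ n x y, (s (n + 1)).right x = (s (n + 1)).right y →
      (s n).right x = (s n).right y := by
    intro n x y h
    obtain ⟨α, -, h2⟩ := hr n
    simpa [← h2] using congrArg α h
  have hlr : ∀ n x y, (s (n + 1)).left x = (s (n + 1)).right y →
      (s n).left x = (s n).right y := by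
    intro n x y h
    obtain ⟨α, h1, h2⟩ := hr n
    simpa [← h1, ← h2] using congrArg α h
  have hsl : ∀ x y, (∀ n, (s n).left x = (s n).left y) → x = y := by
    intro x y h
    refine eq_of_forall_clopens fun W hx => ?_
    obtain ⟨n, rfl⟩ := hU W
    exact hnextU (s n) n x y (h (n + 1)) hx
  have hsr : ∀ x y, (∀ n, (s n).right x = (s n).right y) → x = y := by
    intro x y h
    refine eq_of_forall_clopens fun W hx => ?_
    obtain ⟨n, rfl⟩ := hV W
    exact hnextV (s n) n x y (h (n + 1)) hx
  have hex : ∀ x, ∃ y, ∀ n, (s n).left x = (s n).right y := fun x =>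
    exists_forall_of_isClosed (fun n y => hlr n x y)
      (fun n => isClosed_eq continuous_const (s n).isEpi_right.continuous)
      (fun n => by
        obtain ⟨y, hy⟩ := (s n).isEpi_right.surjective ((s n).left x)
        exact ⟨y, hy.symm⟩)
  have hex' : ∀ y, ∃ x, ∀ n, (s n).left x = (s n).right y := fun y =>
    exists_forall_of_isClosed (fun n x => hlr n x y)
      (fun n => isClosed_eq (s n).isEpi_left.continuous continuous_const)
      (fun n => (s n).isEpi_left.surjective ((s n).right y))
  choose ψ hψ using hex
  have hbij : Function.Bijective ψ := by
    constructor
    · intro x y h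
      refine hsl x y fun n => ?_
      rw [hψ x n, hψ y n, h]
    · intro y
      obtain ⟨x, hx⟩ := hex' y
      exact ⟨x, hsr _ _ fun n => by rw [← hψ x n, hx n]⟩
  have hcont : Continuous ψ := by
    have hj : IsClosedEmbedding fun y n => (s n).right y :=
      (continuous_pi fun n => (s n).isEpi_right.continuous).isClosedEmbedding
        fun x y h => hsr x y (congrFun h)
    rw [hj.isInducing.continuous_iff]
    refine continuous_pi fun n => ?_
    simp only [Function.comp_apply, ← hψ]
    exact (s n).isEpi_left.continuous
  have hrel : ∀ i x y, L.rel i x y ↔ L'.rel i (ψ x) (ψ y) := by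
    intro i x y
    rw [rel_iff_forall (fun n => (s n).isEpi_left) hl hsl,
      rel_iff_forall (fun n => (s n).isEpi_right) hrt hsr]
    simp only [hψ]
  refine ⟨ψ, ⟨hbij, hcont, hbij.2, fun i x y => ?_⟩, funext fun x => (hψ x 0).symm⟩
  constructor
  · intro h
    obtain ⟨x, rfl⟩ := hbij.2 x
    obtain ⟨y, rfl⟩ := hbij.2 y
    exact ⟨x, y, rfl, rfl, (hrel i x y).2 h⟩
  · rintro ⟨x, y, rfl, rfl, h⟩
    exact (hrel i x y).1 h

end BackAndForth

theorem IsProjFraisseLimit.hasExtensions {𝓕 : TopStr.{0} m → Prop} {L : TopStr.{u} m}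
    (h : IsProjFraisseLimit 𝓕 L) : HasExtensions 𝓕 L := by
  intro A B hA hB φ α hφ hα
  obtain ⟨β, hβ⟩ := h.universal B hB
  obtain ⟨ψ, hψ, h'⟩ := h.ultrahomogeneous A hA (α ∘ β) φ (hα.comp hβ) hφ
  exact ⟨β ∘ ψ, hβ.comp hψ.2, h'.symm⟩

theorem isProjFraisseLimit_iff {𝓕 : TopStr.{0} m → Prop} (hfin : ∀ A, 𝓕 A → Finite A)
    {L : TopStr.{u} m} : IsProjFraisseLimit 𝓕 L ↔
      (∀ A, 𝓕 A → ∃ φ : L → A, IsEpi L A φ) ∧ HasFactors 𝓕 L ∧ HasExtensions 𝓕 L := by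
  refine ⟨fun h => ⟨h.universal, fun X _ _ _ => h.factor X, h.hasExtensions⟩, ?_⟩
  rintro ⟨h1, h2, h3⟩
  refine ⟨h1, fun X _ _ _ => h2 X, fun A hA φ₁ φ₂ hφ₁ hφ₂ => ?_⟩
  obtain ⟨ψ, hψ, h⟩ := exists_isIso_of_hasExtensions hfin h2 h2 h3 h3 hA hφ₂ hφ₁
  exact ⟨ψ, hψ, h.symm⟩

theorem IsProjFraisseLimit.exists_isIso {𝓕 : TopStr.{0} m → Prop} (hfin : ∀ A, 𝓕 A → Finite A)
    {L : TopStr.{u} m} {L' : TopStr.{v} m} (h : IsProjFraisseLimit 𝓕 L)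
    (h' : IsProjFraisseLimit 𝓕 L') : ∃ ψ : L → L', IsIso L L' ψ := by
  obtain ⟨A, hA, φ, -, hφ, -⟩ := h.factor Unit (fun _ => ()) continuous_const
  obtain ⟨φ', hφ'⟩ := h'.universal A hA
  obtain ⟨ψ, hψ, -⟩ := exists_isIso_of_hasExtensions hfin (fun X _ _ _ => h.factor X)
    (fun X _ _ _ => h'.factor X) h.hasExtensions h'.hasExtensions hA hφ hφ'
  exact ⟨ψ, hψ⟩

/-! ### Finite partitions of Cantor spaces -/

theorem continuous_of_injective_comp {X A K : Type*} [TopologicalSpace X] [TopologicalSpace A]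
    [TopologicalSpace K] [DiscreteTopology A] [DiscreteTopology K] {φ : X → A} {g : A → K}
    (hg : Function.Injective g) (hc : Continuous (g ∘ φ)) : Continuous φ := by
  rw [continuous_discrete_rng]
  intro a
  convert (isOpen_discrete {g a}).preimage hc using 1
  ext x
  simp [hg.eq_iff]

section Perfect

variable {X : Type u} [TopologicalSpace X] [CompactSpace X] [T2Space X]
  [TotallyDisconnectedSpace X]

/-- Finitely many distinct points can be told apart by a continuous map to a finite set. -/
theorem exists_continuous_leftInverse {K : Type*} [Finite K] [Nonempty K] [TopologicalSpace K]
    [DiscreteTopology K] {u : K → X} (hu : Function.Injective u) :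
    ∃ g : X → K, Continuous g ∧ ∀ k, g (u k) = k := by
  classical
  have h : ∀ k, ∃ V : Clopens X, u k ∈ V ∧ ∀ j, j ≠ k → u j ∉ V := by
    intro k
    obtain ⟨V, hV, hk, hVU⟩ := compact_exists_isClopen_in_isOpen
      (U := (u '' {j | j ≠ k})ᶜ) (Set.toFinite _).isClosed.isOpen_compl (x := u k)
      (by rintro ⟨j, hj, h⟩; exact hj (hu h))
    exact ⟨⟨V, hV⟩, hk, fun j hj hjV => hVU hjV ⟨j, hj, rfl⟩⟩
  choose V hV hV' using h
  let c : X → K → Bool := fun x k => (V k : Set X).boolIndicator x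
  have hc : Continuous c :=
    continuous_pi fun k => (continuous_boolIndicator_iff_isClopen _).2 (V k).isClopen
  have hinj : Function.Injective fun k => c (u k) := by
    intro j k hjk
    by_contra hne
    have := congrFun hjk j
    simp [c, Set.boolIndicator, hV j, hV' j k (Ne.symm hne)] at this
  exact ⟨fun x => Function.invFun (fun k => c (u k)) (c x),
    (continuous_of_discreteTopology (f := Function.invFun fun k => c (u k))).comp hc,
    fun k => Function.leftInverse_invFun hinj k⟩

/-- A finite partition of a space without isolated points into clopen sets can be refined
according to any surjection of finite sets. -/
theorem exists_continuous_lift [PerfectSpace X] {A B : Type} [Finite B]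
    [TopologicalSpace A] [DiscreteTopology A] [TopologicalSpace B] [DiscreteTopology B]
    {φ : X → A} (hφ : Continuous φ) (hφ' : Function.Surjective φ) {α : B → A}
    (hα : Function.Surjective α) :
    ∃ β : X → B, Continuous β ∧ Function.Surjective β ∧ α ∘ β = φ := by
  classical
  rcases isEmpty_or_nonempty B with hB | hB
  · have hX : IsEmpty X := ⟨fun x => hB.elim (hα (φ x)).choose⟩
    exact ⟨fun x => (hX.elim x), continuous_of_const fun x => (hX.elim x),
      fun b => hB.elim b, funext fun x => hX.elim x⟩
  have hinf : ∀ a, Infinite (φ ⁻¹' {a}) := by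
    intro a
    obtain ⟨x, rfl⟩ := hφ' a
    exact (infinite_of_mem_nhds x
      (((isOpen_discrete {φ x}).preimage hφ).mem_nhds rfl)).to_subtype
  let u : B → X := fun b =>
    (Infinite.natEmbedding (φ ⁻¹' {α b}) (Finite.equivFin B b) : φ ⁻¹' {α b})
  have hφu : ∀ b, φ (u b) = α b := fun b =>
    (Infinite.natEmbedding (φ ⁻¹' {α b}) (Finite.equivFin B b)).2
  have hu : Function.Injective u := by
    intro b b' h
    have hab : α b = α b' := by rw [← hφu, ← hφu, h]
    have key : ∀ a a' (_ : a = a') (j k : ℕ), ((Infinite.natEmbedding (φ ⁻¹' {a}) j :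
        φ ⁻¹' {a}) : X) = (Infinite.natEmbedding (φ ⁻¹' {a'}) k : φ ⁻¹' {a'}) → j = k := by
      rintro a _ rfl j k hjk
      exact (Infinite.natEmbedding _).injective (Subtype.ext hjk)
    exact (Finite.equivFin B).injective (Fin.ext (key _ _ hab _ _ h))
  obtain ⟨g, hg, hgu⟩ := exists_continuous_leftInverse hu
  let t : A × B → B := fun z => if α z.2 = z.1 then z.2 else Function.surjInv hα z.1
  refine ⟨fun x => t (φ x, g x), (continuous_of_discreteTopology (f := t)).comp (hφ.prodMk hg),
    fun b => ⟨u b, ?_⟩, funext fun x => ?_⟩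
  · simp [t, hgu, hφu]
  · simp only [t, Function.comp_apply]
    split_ifs with h
    · exact h
    · exact Function.surjInv_eq hα _

variable (X) in
/-- A space as a structure for the empty language. -/
def spaceStr [SecondCountableTopology X] : TopStr.{u} 0 where
  carrier := X
  rel i := i.elim0
  isClosed_rel i := i.elim0

theorem hasFactors_spaceStr [SecondCountableTopology X] [Nonempty X] :
    HasFactors (fun A => Finite A ∧ Nonempty A) (spaceStr X) := by
  intro K _ _ _ f hf
  have : DiscreteTopology (ofFinite (Set.range f) (fun i : Fin 0 => i.elim0)) := ⟨rfl⟩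
  obtain ⟨x⟩ := ‹Nonempty X›
  exact ⟨ofFinite (Set.range f) fun i => i.elim0,
    ⟨inferInstanceAs (Finite (Set.range f)), ⟨f x, x, rfl⟩⟩, Set.rangeFactorization f,
    Subtype.val, ⟨continuous_of_injective_comp Subtype.val_injective hf,
      Set.rangeFactorization_surjective, fun i => i.elim0⟩, rfl⟩

theorem hasExtensions_spaceStr [SecondCountableTopology X] [PerfectSpace X] :
    HasExtensions (fun A => Finite A ∧ Nonempty A) (spaceStr X) := by
  rintro A B ⟨_, -⟩ ⟨_, -⟩ φ α hφ hα
  have : PerfectSpace (spaceStr X) := ‹PerfectSpace X›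
  obtain ⟨β, h1, h2, h3⟩ :=
    exists_continuous_lift (X := spaceStr X) hφ.continuous hφ.surjective hα.surjective
  exact ⟨β, ⟨h1, h2, fun i => i.elim0⟩, h3⟩

end Perfect

/-- Two Cantor spaces are homeomorphic, by a homeomorphism which respects given finite partitions
into non-empty clopen sets. This is the back and forth for the empty language. -/
theorem exists_homeomorph_over {X : Type u} [TopologicalSpace X] [CompactSpace X] [T2Space X]
    [TotallyDisconnectedSpace X] [SecondCountableTopology X] [PerfectSpace X]
    {Y : Type v} [TopologicalSpace Y] [CompactSpace Y] [T2Space Y] [TotallyDisconnectedSpace Y]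
    [SecondCountableTopology Y] [PerfectSpace Y] {K : Type} [Finite K] [Nonempty K]
    [TopologicalSpace K] [DiscreteTopology K] {φ : X → K} {φ' : Y → K} (hφ : Continuous φ)
    (hs : Function.Surjective φ) (hφ' : Continuous φ') (hs' : Function.Surjective φ') :
    ∃ ψ : X ≃ₜ Y, ∀ x, φ' (ψ x) = φ x := by
  obtain ⟨k⟩ := ‹Nonempty K›
  have : Nonempty X := ⟨(hs k).choose⟩
  have : Nonempty Y := ⟨(hs' k).choose⟩
  let A : TopStr.{0} 0 := spaceStr K
  obtain ⟨ψ, hψ, h⟩ := exists_isIso_of_hasExtensions (L := spaceStr X) (L' := spaceStr Y)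
    (𝓕 := fun A => Finite A ∧ Nonempty A) (fun A hA => hA.1) hasFactors_spaceStr
    hasFactors_spaceStr hasExtensions_spaceStr hasExtensions_spaceStr (A := A)
    ⟨‹Finite K›, ⟨k⟩⟩ (φ := φ) (φ' := φ') ⟨hφ, hs, fun i => i.elim0⟩ ⟨hφ', hs', fun i => i.elim0⟩
  exact ⟨Continuous.homeoOfEquivCompactToT2 (f := Equiv.ofBijective ψ hψ.1) hψ.2.continuous,
    congrFun h⟩

instance perfectSpace_pi_nat {K : Type u} [TopologicalSpace K] [DiscreteTopology K]
    [Nontrivial K] : PerfectSpace (ℕ → K) := by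
  classical
  rw [perfectSpace_iff_forall_not_isolated]
  intro x
  rw [← mem_closure_iff_nhdsWithin_neBot]
  choose c hc using fun a : K => exists_ne a
  -- Changing a single coordinate further and further out gives points tending to `x`.
  refine mem_closure_of_tendsto (f := fun n => Function.update x n (c (x n)))
    (b := Filter.atTop) ?_ (Filter.Eventually.of_forall fun n h => ?_)
  · rw [tendsto_pi_nhds]
    intro k
    refine tendsto_const_nhds.congr' ?_
    filter_upwards [Filter.eventually_gt_atTop k] with n hn
    rw [Function.update_of_ne hn.ne]
  · have := congrFun h n
    simp [hc] at this

/-! ### Existence of the limit -/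

/-- Structures on initial segments of `ℕ`: countably many representatives of all finite
structures. -/
def Code (m : ℕ) : Type := Σ k : ℕ, Fin m → Fin k → Fin k → Prop

instance : Countable (Code m) :=
  inferInstanceAs (Countable (Σ k : ℕ, Fin m → Fin k → Fin k → Prop))

/-- The structure with a given code. -/
def Code.str (c : Code m) : TopStr.{0} m := ofFinite (Fin c.1) c.2

instance (c : Code m) : Finite c.str := inferInstanceAs (Finite (Fin c.1))

instance countable_continuousMap {X : Type u} [TopologicalSpace X] [CompactSpace X] [T2Space X]
    [TotallyDisconnectedSpace X] [SecondCountableTopology X] {K : Type v} [TopologicalSpace K]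
    [DiscreteTopology K] [Finite K] : Countable C(X, K) := by
  have := Clopens.countable_iff_secondCountable.2 ‹SecondCountableTopology X›
  refine Function.Injective.countable (β := K → Clopens X)
    (f := fun f k => ⟨f ⁻¹' {k}, (isClopen_discrete {k}).preimage f.continuous⟩) ?_
  intro f g h
  ext x
  have hx : x ∈ (⟨f ⁻¹' {f x}, (isClopen_discrete {f x}).preimage f.continuous⟩ : Clopens X) := rfl
  have h' := congrFun h (f x)
  simp only at h'
  rw [h'] at hx
  exact (show g x = f x from hx).symm

theorem isEpi_of_equiv {A B : TopStr.{0} m} [Finite A] (e : A ≃ B)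
    (he : ∀ i x y, A.rel i x y ↔ B.rel i (e x) (e y)) : IsEpi A B e where
  continuous := continuous_of_finite _
  surjective := e.surjective
  rel_iff i x y := by
    constructor
    · intro h
      exact ⟨e.symm x, e.symm y, by simp, by simp, by simpa [he] using h⟩
    · rintro ⟨x, y, rfl, rfl, h⟩
      exact (he i x y).1 h

theorem exists_code (A : TopStr.{0} m) [Finite A] :
    ∃ (c : Code m) (e : A ≃ c.str), ∀ i x y, A.rel i x y ↔ c.str.rel i (e x) (e y) := by
  let e := Finite.equivFin A
  refine ⟨⟨Nat.card A, fun i x y => A.rel i (e.symm x) (e.symm y)⟩, e, fun i x y => ?_⟩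
  change A.rel i x y ↔ A.rel i (e.symm (e x)) (e.symm (e y))
  rw [e.symm_apply_apply, e.symm_apply_apply]

theorem AmpleFamily.exists_code {A : TopStr.{0} m} (hA : AmpleFamily m A) :
    ∃ c : Code m, AmpleFamily m c.str ∧ ∃ e : A ≃ c.str, IsEpi A c.str e ∧
      IsEpi c.str A e.symm := by
  have := hA.finite
  obtain ⟨c, e, he⟩ := _root_.exists_code A
  have he' : ∀ i x y, c.str.rel i x y ↔ A.rel i (e.symm x) (e.symm y) := by
    intro i x y
    simp [he]
  exact ⟨c, hA.of_equiv e.symm he', e, isEpi_of_equiv e he, isEpi_of_equiv e.symm he'⟩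

/-- Limits of the family are characterised by countably many conditions. -/
theorem isProjFraisseLimit_ampleFamily_iff {L : TopStr.{u} m} :
    IsProjFraisseLimit (AmpleFamily m) L ↔
      (∀ c : Code m, AmpleFamily m c.str → ∃ φ : C(L, c.str), IsEpi L c.str φ) ∧
      (∀ n (f : C(L, Fin n)), ∃ c : Code m, AmpleFamily m c.str ∧
        ∃ (φ : C(L, c.str)) (f₀ : c.str → Fin n), IsEpi L c.str φ ∧ f = f₀ ∘ φ) ∧
      (∀ c d : Code m, AmpleFamily m c.str → AmpleFamily m d.str →
        ∀ (φ : C(L, c.str)) (α : d.str → c.str), IsEpi d.str c.str α → IsEpi L c.str φ →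
          ∃ β : C(L, d.str), IsEpi L d.str β ∧ α ∘ β = φ) := by
  rw [isProjFraisseLimit_iff fun A hA => hA.finite]
  constructor
  · rintro ⟨h1, h2, h3⟩
    refine ⟨fun c hc => ?_, fun n f => ?_, fun c d hc hd φ α hα hφ => ?_⟩
    · obtain ⟨φ, hφ⟩ := h1 _ hc
      exact ⟨⟨φ, hφ.continuous⟩, hφ⟩
    · obtain ⟨A, hA, φ, f₀, hφ, hf⟩ := h2 (Fin n) f f.continuous
      obtain ⟨c, hc, e, he, he'⟩ := hA.exists_code
      refine ⟨c, hc, ⟨_, (he.comp hφ).continuous⟩, f₀ ∘ e.symm, he.comp hφ, ?_⟩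
      rw [hf]
      ext x
      simp
    · obtain ⟨β, hβ, h⟩ := h3 _ _ hc hd φ α hφ hα
      exact ⟨⟨β, hβ.continuous⟩, hβ, h⟩
  · rintro ⟨h1, h2, h3⟩
    refine ⟨fun A hA => ?_, fun K _ _ _ f hf => ?_, fun A B hA hB φ α hφ hα => ?_⟩
    · obtain ⟨c, hc, e, he, he'⟩ := hA.exists_code
      obtain ⟨φ, hφ⟩ := h1 c hc
      exact ⟨_, he'.comp hφ⟩
    · let e := Finite.equivFin K
      obtain ⟨c, hc, φ, f₀, hφ, h⟩ := h2 _ ⟨e ∘ f, continuous_of_discreteTopology.comp hf⟩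
      refine ⟨c.str, hc, φ, e.symm ∘ f₀, hφ, ?_⟩
      rw [Function.comp_assoc, ← h]
      ext x
      simp
    · obtain ⟨c, hc, e, he, he'⟩ := hA.exists_code
      obtain ⟨d, hd, e₁, he₁, he₁'⟩ := hB.exists_code
      obtain ⟨β, hβ, h⟩ := h3 c d hc hd ⟨_, (he.comp hφ).continuous⟩ _
        ((he.comp hα).comp he₁') (he.comp hφ)
      refine ⟨_, he₁'.comp hβ, ?_⟩
      ext x
      simpa using congrFun h x

section Generic

variable (m) (X : Type u) [TopologicalSpace X]

/-- A finite approximation to a structure on the space `X`: a continuous map onto a member of the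
family. -/
structure Approx where
  str : TopStr.{0} m
  mem : AmpleFamily m str
  proj : X → str
  continuous : Continuous proj
  surjective : Function.Surjective proj

/-- Larger approximations are finer: they project onto the smaller ones by epimorphisms. -/
instance : Preorder (Approx m X) where
  le p q := ∃ α : q.str → p.str, IsEpi q.str p.str α ∧ α ∘ q.proj = p.proj
  le_refl p :=
    have := p.mem.finite
    ⟨Equiv.refl _, isEpi_of_equiv (Equiv.refl _) fun _ _ _ => Iff.rfl, rfl⟩
  le_trans p q r := by
    rintro ⟨α, hα, h⟩ ⟨β, hβ, h'⟩
    exact ⟨α ∘ β, hα.comp hβ, by rw [Function.comp_assoc, h', h]⟩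

variable {m X} [CompactSpace X] [T2Space X] [TotallyDisconnectedSpace X]

/-- The structure on `X` which is the limit of a sequence of approximations. -/
def limitStr [SecondCountableTopology X] (s : ℕ → Approx m X) : TopStr.{u} m where
  carrier := X
  rel i x y := ∀ n, (s n).str.rel i ((s n).proj x) ((s n).proj y)
  isClosed_rel i := by
    simp only [Set.ofPred_forall]
    exact isClosed_iInter fun n => ((s n).str.isClosed_rel i).preimage
      ((s n).continuous.prodMap (s n).continuous)

theorem isEpi_limitStr [SecondCountableTopology X] {s : ℕ → Approx m X} (hs : Monotone s) (n : ℕ) :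
    IsEpi (limitStr s) (s n).str (s n).proj where
  continuous := (s n).continuous
  surjective := (s n).surjective
  rel_iff i a b := by
    constructor
    · intro hab
      have hle : ∀ {j k}, j ≤ k → ∀ {x y}, (s k).str.rel i ((s k).proj x) ((s k).proj y) →
          (s j).str.rel i ((s j).proj x) ((s j).proj y) := by
        intro j k hjk x y h
        obtain ⟨α, hα, h'⟩ := hs hjk
        rw [← h']
        exact (hα.rel_iff _ _ _).2 ⟨_, _, rfl, rfl, h⟩
      obtain ⟨p, hp⟩ := exists_forall_of_isClosed (X := X × X)
        (p := fun k p => (s (n + k)).str.rel i ((s (n + k)).proj p.1) ((s (n + k)).proj p.2) ∧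
          (s n).proj p.1 = a ∧ (s n).proj p.2 = b)
        (fun k p h => ⟨hle (Nat.le_succ _) h.1, h.2⟩)
        (fun k => (((s (n + k)).str.isClosed_rel i).preimage
          ((s (n + k)).continuous.prodMap (s (n + k)).continuous)).inter
          ((isClosed_eq ((s n).continuous.comp continuous_fst) continuous_const).inter
            (isClosed_eq ((s n).continuous.comp continuous_snd) continuous_const)))
        (fun k => by
          obtain ⟨α, hα, h'⟩ := hs (Nat.le_add_right n k)
          obtain ⟨a', b', rfl, rfl, h⟩ := (hα.rel_iff _ _ _).1 hab
          obtain ⟨x, rfl⟩ := (s (n + k)).surjective a'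
          obtain ⟨y, rfl⟩ := (s (n + k)).surjective b'
          exact ⟨(x, y), h, (congrFun h' x).symm, (congrFun h' y).symm⟩)
      exact ⟨p.1, p.2, (hp 0).2.1, (hp 0).2.2, fun k => hle (Nat.le_add_left k n) (hp k).1⟩
    · rintro ⟨x, y, rfl, rfl, h⟩
      exact h n

variable (m X) in
/-- The requirements met by a generic sequence of approximations: to factor a given map to a
finite set, to map onto a given member, and to solve a given extension problem. -/
abbrev Requirement : Type u :=
  (Σ n : ℕ, C(X, Fin n)) ⊕ {c : Code m // AmpleFamily m c.str} ⊕
    (Σ c : {c : Code m // AmpleFamily m c.str}, Σ d : {d : Code m // AmpleFamily m d.str},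
      C(X, c.1.str) × (d.1.str → c.1.str))

/-- The approximations which meet a requirement. -/
def Requirement.Met : Requirement m X → Approx m X → Prop
  | .inl ⟨_, f⟩, p => ∃ g, g ∘ p.proj = f
  | .inr (.inl c), p => ∃ γ : p.str → c.1.str, IsEpi p.str c.1.str γ
  | .inr (.inr ⟨c, d, φ, α⟩), p => ∃ γ : p.str → c.1.str, γ ∘ p.proj = φ ∧
      (IsEpi d.1.str c.1.str α → IsEpi p.str c.1.str γ →
        ∃ β : p.str → d.1.str, IsEpi p.str d.1.str β ∧ α ∘ β = γ)

theorem isProjFraisseLimit_limitStr [SecondCountableTopology X] {s : ℕ → Approx m X}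
    (hs : Monotone s) (h : ∀ r : Requirement m X, ∃ n, r.Met (s n)) :
    IsProjFraisseLimit (AmpleFamily m) (limitStr s) := by
  have hepi := isEpi_limitStr hs
  refine isProjFraisseLimit_ampleFamily_iff.2 ⟨fun c hc => ?_, fun k f => ?_,
    fun c d hc hd φ α hα hφ => ?_⟩
  · obtain ⟨n, γ, hγ⟩ := h (.inr (.inl ⟨c, hc⟩))
    exact ⟨⟨_, (hγ.comp (hepi n)).continuous⟩, hγ.comp (hepi n)⟩
  · obtain ⟨n, g, hg⟩ := h (.inl ⟨k, f⟩)
    obtain ⟨c, hc, e, he, he'⟩ := (s n).mem.exists_code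
    refine ⟨c, hc, ⟨_, (he.comp (hepi n)).continuous⟩, g ∘ e.symm, he.comp (hepi n), ?_⟩
    ext1 x
    exact (congrFun hg x).symm.trans (congrArg g (e.symm_apply_apply _).symm)
  · obtain ⟨n, γ, hγ, h'⟩ := h (.inr (.inr ⟨⟨c, hc⟩, ⟨d, hd⟩, φ, α⟩))
    have := (s n).mem.finite
    obtain ⟨β, hβ, hαβ⟩ := h' hα (IsEpi.of_comp (hγ ▸ hφ) (hepi n))
    refine ⟨⟨_, (hβ.comp (hepi n)).continuous⟩, hβ.comp (hepi n), ?_⟩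
    ext1 x
    exact (congrFun hαβ _).trans (congrFun hγ x)

variable [PerfectSpace X]

theorem Approx.exists_ge (p : Approx m X) {B : TopStr.{0} m} (hB : AmpleFamily m B)
    {α : B → p.str} (hα : IsEpi B p.str α) :
    ∃ β : X → B, Continuous β ∧ Function.Surjective β ∧ α ∘ β = p.proj :=
  have := p.mem.finite
  have := hB.finite
  exists_continuous_lift p.continuous p.surjective hα.surjective

/-- Every approximation can be refined so that a given map to a finite set factors. -/
theorem Approx.exists_ge_factor (hm : 1 ≤ m) (p : Approx m X) {K : Type} [Finite K]
    [TopologicalSpace K] [DiscreteTopology K] {f : X → K} (hf : Continuous f) :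
    ∃ q, p ≤ q ∧ ∃ g : q.str → K, g ∘ q.proj = f := by
  have := p.mem.finite
  let ρ : X → p.str × K := fun x => (p.proj x, f x)
  let π : Set.range ρ → p.str := fun z => z.1.1
  have hπ : Function.Surjective π := fun a => by
    obtain ⟨x, rfl⟩ := p.surjective a
    exact ⟨⟨ρ x, x, rfl⟩, rfl⟩
  let E := p.str.pullback (Set.range ρ) π
  have : Finite E := inferInstanceAs (Finite (Set.range ρ))
  obtain ⟨D, hD, δ, hδ, -⟩ := (p.mem.finSurj.pullback _ hπ).exists_cover hm
  have := hD.finite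
  let φ : X → E := Set.rangeFactorization ρ
  have hφ : Continuous φ := continuous_of_injective_comp (A := E) (K := p.str × K)
    (g := fun z : Set.range ρ => z.1) Subtype.val_injective (p.continuous.prodMk hf)
  obtain ⟨β, h1, h2, h3⟩ := exists_continuous_lift hφ Set.rangeFactorization_surjective
    hδ.surjective
  refine ⟨⟨D, hD, β, h1, h2⟩, ⟨π ∘ δ, (isEpi_pullback _ _ hπ).comp hδ, ?_⟩,
    fun d => (show Set.range ρ from δ d).1.2, ?_⟩
  · ext x
    exact congrArg π (congrFun h3 x)
  · ext x
    exact congrArg (fun z : Set.range ρ => z.1.2) (congrFun h3 x)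

theorem Requirement.exists_met (hm : 1 ≤ m) (r : Requirement m X) (p : Approx m X) :
    ∃ q, p ≤ q ∧ r.Met q := by
  have hF := isProjFraisseFamily_ampleFamily hm
  match r with
  | .inl ⟨n, f⟩ => exact p.exists_ge_factor hm f.continuous
  | .inr (.inl c) =>
    obtain ⟨C, hC, ⟨φ, hφ⟩, ψ, hψ⟩ := hF.jpp _ _ p.mem c.2
    obtain ⟨β, h1, h2, h3⟩ := p.exists_ge hC hφ
    exact ⟨⟨C, hC, β, h1, h2⟩, ⟨φ, hφ, h3⟩, ψ, hψ⟩
  | .inr (.inr ⟨c, d, φ, α⟩) =>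
    obtain ⟨q, hpq, γ, hγ⟩ := p.exists_ge_factor hm φ.continuous
    by_cases h : IsEpi d.1.str c.1.str α ∧ IsEpi q.str c.1.str γ
    · obtain ⟨C, hC, φ₃, φ₄, h₃, h₄, h'⟩ := hF.ap _ _ _ c.2 q.mem d.2 _ _ h.2 h.1
      obtain ⟨β, h1, h2, h3⟩ := q.exists_ge hC h₃
      refine ⟨⟨C, hC, β, h1, h2⟩, hpq.trans ⟨φ₃, h₃, h3⟩, γ ∘ φ₃, ?_,
        fun _ _ => ⟨φ₄, h₄, h'.symm⟩⟩
      change (γ ∘ φ₃) ∘ β = φ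
      rw [Function.comp_assoc, h3, hγ]
    · exact ⟨q, hpq, γ, hγ, fun h1 h2 => (h ⟨h1, h2⟩).elim⟩

theorem exists_generic [SecondCountableTopology X] [Nonempty X] (hm : 1 ≤ m) :
    ∃ s : ℕ → Approx m X, Monotone s ∧ ∀ r : Requirement m X, ∃ n, r.Met (s n) := by
  have : Encodable (Requirement m X) := Encodable.ofCountable _
  obtain ⟨A, hA⟩ := exists_ampleFamily hm
  have := hA.finite
  have := hA.nonempty
  obtain ⟨β, h1, h2, -⟩ := exists_continuous_lift (X := X) (A := Unit) (B := A)
    (φ := fun _ => ()) continuous_const (fun _ => ‹Nonempty X›.elim fun x => ⟨x, rfl⟩)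
    (α := fun _ => ()) (fun _ => ‹Nonempty A›.elim fun x => ⟨x, rfl⟩)
  let D : Requirement m X → Order.Cofinal (Approx m X) := fun r =>
    ⟨{p | r.Met p}, fun p => by
      obtain ⟨q, h, h'⟩ := r.exists_met hm p
      exact ⟨q, h', h⟩⟩
  exact ⟨Order.sequenceOfCofinals ⟨A, hA, β, h1, h2⟩ D, Order.sequenceOfCofinals.monotone _ _,
    fun r => ⟨_, Order.sequenceOfCofinals.encode_mem _ D r⟩⟩

end Generic

theorem exists_isProjFraisseLimit (hm : 1 ≤ m) :
    ∃ L : TopStr.{u} m, IsProjFraisseLimit (AmpleFamily m) L := by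
  obtain ⟨s, hs, h⟩ := exists_generic (X := ℕ → ULift.{u} Bool) hm
  exact ⟨_, isProjFraisseLimit_limitStr hs h⟩

/-! ### The relations of the limit are graphs of homeomorphisms -/

theorem TopStr.isClosed_signedRel (L : TopStr.{u} m) (R : Fin m × Bool) :
    IsClosed {p : L × L | L.signedRel R p.1 p.2} := by
  obtain ⟨i, b⟩ := R
  cases b
  · simpa [signedRel] using (L.isClosed_rel i).preimage continuous_swap
  · simpa [signedRel] using L.isClosed_rel i

section Limit

variable {L : TopStr.{u} m}

/-- Clopen subsets of the limit are unions of fibres of an epimorphism onto a member. -/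
theorem IsProjFraisseLimit.exists_epi_clopens {𝓕 : TopStr.{0} m → Prop}
    (h : IsProjFraisseLimit 𝓕 L) {V : Set L} (hV : IsClopen V) :
    ∃ A, 𝓕 A ∧ ∃ φ : L → A, IsEpi L A φ ∧ ∀ x y, φ x = φ y → x ∈ V → y ∈ V := by
  obtain ⟨A, hA, φ, f₀, hφ, hf⟩ := h.factor Bool V.boolIndicator
    ((continuous_boolIndicator_iff_isClopen _).2 hV)
  refine ⟨A, hA, φ, hφ, fun x y hxy hx => ?_⟩
  rw [Set.mem_iff_boolIndicator, hf, Function.comp_apply] at hx ⊢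
  rwa [← hxy]

theorem IsProjFraisseLimit.existsUnique_signedRel (hm : 1 ≤ m)
    (h : IsProjFraisseLimit (AmpleFamily m) L) (R : Fin m × Bool) (x : L) :
    ∃! y, L.signedRel R x y := by
  apply existsUnique_of_exists_of_unique
  · by_contra hx
    have hS : IsClosed (Prod.fst '' {p : L × L | L.signedRel R p.1 p.2}) :=
      ((L.isClosed_signedRel R).isCompact.image continuous_fst).isClosed
    obtain ⟨V, hV, hxV, hVS⟩ := compact_exists_isClopen_in_isOpen hS.isOpen_compl (x := x)
      (by rintro ⟨p, hp, rfl⟩; exact hx ⟨_, hp⟩)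
    obtain ⟨A, hA, φ, hφ, hVφ⟩ := h.exists_epi_clopens hV
    obtain ⟨b, hb⟩ := hA.finSurj.surj R (φ x)
    obtain ⟨x', y', hx', -, hr⟩ := (hφ.signedRel_iff _ _ _).1 hb
    exact hVS (hVφ x x' hx'.symm hxV) ⟨(x', y'), hr, rfl⟩
  · intro y y' hy hy'
    refine eq_of_forall_clopens fun V hyV => ?_
    obtain ⟨A, hA, φ, hφ, hVφ⟩ := h.exists_epi_clopens V.isClopen
    obtain ⟨B, hB, π, hπ, hπ'⟩ := hA.finSurj.exists_cover hm
    obtain ⟨β, hβ, rfl⟩ := h.hasExtensions A B hA hB φ π hφ hπ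
    exact hVφ y y' (hπ' R (β x) (β y) (β y') (hβ.map hy) (hβ.map hy')) hyV

/-- The limit has no isolated points: an isolated point would be the whole fibre over a point of
a member, but that point branches. -/
theorem IsProjFraisseLimit.perfectSpace (hm : 1 ≤ m)
    (h : IsProjFraisseLimit (AmpleFamily m) L) : PerfectSpace L := by
  rw [perfectSpace_iff_forall_not_isolated]
  intro x
  rw [Filter.neBot_iff, Ne, ← isOpen_singleton_iff_punctured_nhds]
  intro hx
  obtain ⟨A, hA, φ, hφ, hV⟩ := h.exists_epi_clopens ⟨isClosed_singleton, hx⟩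
  obtain ⟨-, -, τ, hτ⟩ := ampleFamily_iff.1 hA
  obtain ⟨z, w, hzw, hz, hw⟩ := hτ.branch (φ x)
  obtain ⟨x₁, z, h₁, rfl, hz'⟩ := (hφ.signedRel_iff _ _ _).1 hz
  obtain ⟨x₂, w, h₂, rfl, hw'⟩ := (hφ.signedRel_iff _ _ _).1 hw
  obtain rfl : x₁ = x := hV x x₁ h₁.symm rfl
  obtain rfl : x₂ = x₁ := hV x₁ x₂ h₂.symm rfl
  exact hzw (congrArg φ ((h.existsUnique_signedRel hm _ _).unique hz' hw'))

theorem IsProjFraisseLimit.nonempty (hm : 1 ≤ m) (h : IsProjFraisseLimit (AmpleFamily m) L) :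
    Nonempty L := by
  obtain ⟨A, hA⟩ := exists_ampleFamily hm
  obtain ⟨φ, hφ⟩ := h.universal A hA
  obtain ⟨a⟩ := hA.nonempty
  exact ⟨(hφ.surjective a).choose⟩

theorem exists_homeomorph_of_graph {X : Type u} [TopologicalSpace X] [CompactSpace X] [T2Space X]
    {r : X → X → Prop} (hr : IsClosed {p : X × X | r p.1 p.2}) (h₁ : ∀ x, ∃! y, r x y)
    (h₂ : ∀ y, ∃! x, r x y) : ∃ F : X ≃ₜ X, ∀ x y, r x y ↔ F x = y := by
  let C := {p : X × X | r p.1 p.2}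
  have : CompactSpace C := isCompact_iff_compactSpace.1 hr.isCompact
  have hf : Function.Bijective fun p : C => p.1.1 := by
    constructor
    · rintro ⟨⟨x, y⟩, hp⟩ ⟨⟨x', y'⟩, hq⟩ (rfl : x = x')
      obtain rfl := (h₁ x).unique hp hq
      rfl
    · intro x
      obtain ⟨y, hy, -⟩ := h₁ x
      exact ⟨⟨(x, y), hy⟩, rfl⟩
  have hs : Function.Bijective fun p : C => p.1.2 := by
    constructor
    · rintro ⟨⟨x, y⟩, hp⟩ ⟨⟨x', y'⟩, hq⟩ (rfl : y = y')
      obtain rfl := (h₂ y).unique hp hq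
      rfl
    · intro y
      obtain ⟨x, hx, -⟩ := h₂ y
      exact ⟨⟨(x, y), hx⟩, rfl⟩
  let a : C ≃ₜ X := Continuous.homeoOfEquivCompactToT2 (f := Equiv.ofBijective _ hf)
    (continuous_fst.comp continuous_subtype_val)
  let b : C ≃ₜ X := Continuous.homeoOfEquivCompactToT2 (f := Equiv.ofBijective _ hs)
    (continuous_snd.comp continuous_subtype_val)
  refine ⟨a.symm.trans b, fun x y => ?_⟩
  have key : r x (b (a.symm x)) := by
    have h1 : (a.symm x).1.1 = x := a.apply_symm_apply x
    have h2 := (a.symm x).2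
    change r (a.symm x).1.1 (a.symm x).1.2 at h2
    rwa [h1] at h2
  exact ⟨fun h => (h₁ x).unique key h, fun h => h ▸ key⟩

theorem IsProjFraisseLimit.exists_homeomorph (hm : 1 ≤ m)
    (h : IsProjFraisseLimit (AmpleFamily m) L) (i : Fin m) :
    ∃ F : L ≃ₜ L, ∀ x y, L.rel i x y ↔ F x = y :=
  exists_homeomorph_of_graph (L.isClosed_rel i)
    (fun x => by simpa [signedRel] using h.existsUnique_signedRel hm (i, true) x)
    (fun x => by simpa [signedRel] using h.existsUnique_signedRel hm (i, false) x)

theorem isIso_of_homeomorph {L' : TopStr.{v} m} (ψ : L ≃ₜ L')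
    (hψ : ∀ i x y, L.rel i x y ↔ L'.rel i (ψ x) (ψ y)) : IsIso L L' ψ := by
  refine ⟨ψ.bijective, ψ.continuous, ψ.surjective, fun i x y => ⟨fun h => ?_, ?_⟩⟩
  · exact ⟨ψ.symm x, ψ.symm y, by simp, by simp, by simpa [hψ] using h⟩
  · rintro ⟨x, y, rfl, rfl, h⟩
    exact (hψ i x y).1 h

theorem TopStr.IsIso.exists_homeomorph {L' : TopStr.{v} m} {ψ : L → L'} (hψ : IsIso L L' ψ) :
    ∃ e : L ≃ₜ L', ∀ i x y, L.rel i x y ↔ L'.rel i (e x) (e y) := by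
  refine ⟨Continuous.homeoOfEquivCompactToT2 (f := Equiv.ofBijective ψ hψ.1) hψ.2.continuous,
    fun i x y => ?_⟩
  change _ ↔ L'.rel i (ψ x) (ψ y)
  rw [hψ.2.rel_iff]
  refine ⟨fun h => ⟨x, y, rfl, rfl, h⟩, ?_⟩
  rintro ⟨x', y', hx, hy, h⟩
  rwa [← hψ.1.1 hx, ← hψ.1.1 hy]

theorem IsProjFraisseLimit.of_homeomorph {𝓕 : TopStr.{0} m → Prop} {L' : TopStr.{v} m}
    (h : IsProjFraisseLimit 𝓕 L) (ψ : L ≃ₜ L')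
    (hψ : ∀ i x y, L.rel i x y ↔ L'.rel i (ψ x) (ψ y)) : IsProjFraisseLimit 𝓕 L' := by
  have h₁ : IsIso L L' ψ := isIso_of_homeomorph ψ hψ
  have h₂ : IsIso L' L ψ.symm := isIso_of_homeomorph ψ.symm fun i x y => by simp [hψ]
  refine ⟨fun A hA => ?_, fun X _ _ _ f hf => ?_, fun A hA φ₁ φ₂ hφ₁ hφ₂ => ?_⟩
  · obtain ⟨φ, hφ⟩ := h.universal A hA
    exact ⟨_, hφ.comp h₂.2⟩
  · obtain ⟨A, hA, φ, f₀, hφ, hf⟩ := h.factor X (f ∘ ψ) (hf.comp ψ.continuous)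
    refine ⟨A, hA, φ ∘ ψ.symm, f₀, hφ.comp h₂.2, ?_⟩
    rw [← Function.comp_assoc, ← hf]
    ext x
    simp
  · obtain ⟨χ, hχ, hχ'⟩ := h.ultrahomogeneous A hA _ _ (hφ₁.comp h₁.2) (hφ₂.comp h₁.2)
    refine ⟨ψ ∘ χ ∘ ψ.symm, ⟨h₁.1.comp (hχ.1.comp h₂.1), h₁.2.comp (hχ.2.comp h₂.2)⟩, ?_⟩
    ext x
    simpa using congrFun hχ' (ψ.symm x)

end Limit

/-! ### The conjugacy class is a `Gδ` -/

section Graph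

variable {X : Type u} [TopologicalSpace X] [CompactSpace X] [T2Space X]
  [TotallyDisconnectedSpace X] [SecondCountableTopology X]

/-- The structure on a space whose relations are the graphs of continuous maps. -/
def graphStr (f : Fin m → C(X, X)) : TopStr.{u} m where
  carrier := X
  rel i x y := f i x = y
  isClosed_rel i := isClosed_eq ((f i).continuous.comp continuous_fst) continuous_snd

/-- Being an epimorphism onto a given finite structure is a clopen condition on the maps. -/
theorem isClopen_isEpi_graphStr (A : TopStr.{0} m) [Finite A] (φ : C(X, A)) :
    IsClopen {f : Fin m → C(X, X) | IsEpi (graphStr f) A φ} := by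
  have h₁ : ∀ i a b, IsClopen {f : Fin m → C(X, X) | ∃ x, φ x = a ∧ φ (f i x) = b} := by
    intro i a b
    constructor
    · rw [← isOpen_compl_iff]
      have : {f : Fin m → C(X, X) | ∃ x, φ x = a ∧ φ (f i x) = b}ᶜ =
          {f | Set.MapsTo (f i) (φ ⁻¹' {a}) (φ ⁻¹' {b})ᶜ} := by
        ext f
        simp [Set.MapsTo]
      rw [this]
      have ho : IsOpen {f : C(X, X) | Set.MapsTo f (φ ⁻¹' {a}) (φ ⁻¹' {b})ᶜ} :=
        ContinuousMap.isOpen_setOfPred_mapsTo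
          (isClosed_singleton.preimage φ.continuous).isCompact
          (isClosed_singleton.preimage φ.continuous).isOpen_compl
      exact ho.preimage (continuous_apply (A := fun _ => C(X, X)) i)
    · have : {f : Fin m → C(X, X) | ∃ x, φ x = a ∧ φ (f i x) = b} =
          ⋃ x, ⋃ _ : φ x = a, {f | φ (f i x) = b} := by
        ext f
        simp
      rw [this]
      exact isOpen_iUnion fun x => isOpen_iUnion fun _ => (isOpen_discrete {b}).preimage
        (φ.continuous.comp ((continuous_eval_const x).comp (continuous_apply i)))
  by_cases hs : Function.Surjective φ
  · have : {f : Fin m → C(X, X) | IsEpi (graphStr f) A φ} =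
        ⋂ (i) (a) (b), {f | A.rel i a b ↔ ∃ x, φ x = a ∧ φ (f i x) = b} := by
      ext f
      simp only [Set.mem_iInter]
      constructor
      · intro h i a b
        refine (h.rel_iff i a b).trans ⟨?_, ?_⟩
        · rintro ⟨x, y, hx, hy, rfl⟩
          exact ⟨x, hx, hy⟩
        · rintro ⟨x, hx, hy⟩
          exact ⟨x, _, hx, hy, rfl⟩
      · intro h
        refine ⟨φ.continuous, hs, fun i a b => (h i a b).trans ⟨?_, ?_⟩⟩
        · rintro ⟨x, hx, hy⟩
          exact ⟨x, _, hx, hy, rfl⟩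
        · rintro ⟨x, y, hx, hy, rfl⟩
          exact ⟨x, hx, hy⟩
    rw [this]
    refine isClopen_iInter_of_finite fun i => isClopen_iInter_of_finite fun a =>
      isClopen_iInter_of_finite fun b => ?_
    by_cases hab : A.rel i a b
    · simpa only [hab, true_iff] using h₁ i a b
    · simp only [hab, false_iff]
      exact (h₁ i a b).compl
  · convert isClopen_empty
    exact Set.eq_empty_of_forall_notMem fun f hf => hs hf.surjective

theorem IsGδ.forall_mem {Y : Type u} [TopologicalSpace Y] {ι : Sort*} [Countable ι]
    {p : ι → Y → Prop} (h : ∀ i, IsGδ {y | p i y}) : IsGδ {y | ∀ i, p i y} := by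
  convert IsGδ.iInter h using 1
  ext y
  simp

theorem IsOpen.exists_mem {Y : Type u} [TopologicalSpace Y] {ι : Sort*}
    {p : ι → Y → Prop} (h : ∀ i, IsOpen {y | p i y}) : IsOpen {y | ∃ i, p i y} := by
  convert isOpen_iUnion h using 1
  ext y
  simp

theorem isGδ_isProjFraisseLimit_graphStr :
    IsGδ {f : Fin m → C(X, X) | IsProjFraisseLimit (AmpleFamily m) (graphStr f)} := by
  have ho : ∀ (c : Code m) (φ : C(X, c.str)),
      IsOpen {f : Fin m → C(X, X) | IsEpi (graphStr f) c.str φ} :=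
    fun c φ => (isClopen_isEpi_graphStr c.str φ).isOpen
  have hc : ∀ (c : Code m) (φ : C(X, c.str)),
      IsOpen {f : Fin m → C(X, X) | ¬ IsEpi (graphStr f) c.str φ} :=
    fun c φ => (isClopen_isEpi_graphStr c.str φ).compl.isOpen
  have h1 : IsGδ {f : Fin m → C(X, X) | ∀ c : Code m, AmpleFamily m c.str →
      ∃ φ : C(X, c.str), IsEpi (graphStr f) c.str φ} :=
    IsGδ.forall_mem fun c => IsGδ.forall_mem fun _ => (IsOpen.exists_mem (ho c)).isGδ
  have h2 : IsGδ {f : Fin m → C(X, X) | ∀ n (g : C(X, Fin n)), ∃ c : Code m, AmpleFamily m c.str ∧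
      ∃ (φ : C(X, c.str)) (f₀ : c.str → Fin n), IsEpi (graphStr f) c.str φ ∧ g = f₀ ∘ φ} :=
    IsGδ.forall_mem fun n => IsGδ.forall_mem fun g => IsOpen.isGδ <| IsOpen.exists_mem fun c =>
      isOpen_const.and <| IsOpen.exists_mem fun φ => IsOpen.exists_mem fun f₀ =>
        (ho c φ).and isOpen_const
  have h3 : IsGδ {f : Fin m → C(X, X) | ∀ c d : Code m, AmpleFamily m c.str →
      AmpleFamily m d.str → ∀ (φ : C(X, c.str)) (α : d.str → c.str), IsEpi d.str c.str α →
      IsEpi (graphStr f) c.str φ → ∃ β : C(X, d.str), IsEpi (graphStr f) d.str β ∧ α ∘ β = φ} := by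
    refine IsGδ.forall_mem fun c => IsGδ.forall_mem fun d => IsGδ.forall_mem fun _ =>
      IsGδ.forall_mem fun _ => IsGδ.forall_mem fun φ => IsGδ.forall_mem fun α =>
      IsGδ.forall_mem fun _ => IsOpen.isGδ ?_
    simp only [imp_iff_not_or]
    exact (hc c φ).union (IsOpen.exists_mem fun β => (ho d β).and isOpen_const)
  convert h1.inter (h2.inter h3) using 1
  ext f
  exact isProjFraisseLimit_ampleFamily_iff

end Graph

/-- A tuple of homeomorphisms as a tuple of continuous maps. -/
def toContinuousMaps {X : Type u} [TopologicalSpace X] (h : Fin m → (X ≃ₜ X)) :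
    Fin m → C(X, X) :=
  fun i => ⟨h i, (h i).continuous⟩

theorem continuous_toContinuousMaps {X : Type u} [TopologicalSpace X] :
    Continuous (toContinuousMaps : (Fin m → (X ≃ₜ X)) → Fin m → C(X, X)) :=
  continuous_pi fun i => (continuous_induced_dom
    (f := fun f : X ≃ₜ X => (⟨f, f.continuous⟩ : C(X, X)))).comp (continuous_apply i)

/-- The conjugacy class consists of the tuples whose structure of graphs is a limit, by uniqueness
of the limit. -/
theorem diagConjClass_eq {L : TopStr.{u} m} (h : IsProjFraisseLimit (AmpleFamily m) L)
    {F : Fin m → (L ≃ₜ L)} (hF : ∀ i x y, L.rel i x y ↔ F i x = y) {X : Type v}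
    [TopologicalSpace X] [CompactSpace X] [T2Space X] [TotallyDisconnectedSpace X]
    [SecondCountableTopology X] (e : L ≃ₜ X) :
    (diagConjClass fun i => (e.symm.trans (F i)).trans e) = toContinuousMaps ⁻¹'
      {f : Fin m → C(X, X) | IsProjFraisseLimit (AmpleFamily m) (graphStr f)} := by
  ext k
  constructor
  · rintro ⟨g, hg⟩
    refine h.of_homeomorph (L' := graphStr (toContinuousMaps k)) (e.trans g) fun i x y => ?_
    have : k i (g (e x)) = g (e (F i x)) := by
      rw [hg i]
      change g (e (F i (e.symm (g.symm (g (e x)))))) = _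
      simp
    change _ ↔ k i (g (e x)) = g (e y)
    rw [this, hF]
    simp
  · intro hk
    obtain ⟨ψ, hψ⟩ := h.exists_isIso (fun A hA => hA.finite) hk
    obtain ⟨ψ, hψ⟩ := hψ.exists_homeomorph
    refine ⟨e.symm.trans ψ, fun i => ?_⟩
    ext1 x
    have h1 : graphStr (toContinuousMaps k) |>.rel i (ψ (ψ.symm x)) (ψ (F i (ψ.symm x))) :=
      (hψ i _ _).1 ((hF i _ _).2 rfl)
    change k i (ψ (ψ.symm x)) = ψ (F i (ψ.symm x)) at h1
    change k i x = ψ (e.symm (e (F i (e.symm (e (ψ.symm x))))))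
    rw [e.symm_apply_apply, e.symm_apply_apply, ← h1]
    exact congrArg (k i) (ψ.apply_symm_apply x).symm

/-! ### The conjugacy class is dense -/

section Dense

variable {X : Type u} [TopologicalSpace X] [CompactSpace X] [T2Space X]
  [TotallyDisconnectedSpace X]

/-- A neighbourhood of a continuous self-map contains all maps which agree with it up to some
finite clopen partition. -/
theorem exists_partition_of_isOpen {W : Set C(X, X)} (hW : IsOpen W) {h : C(X, X)} (hh : h ∈ W) :
    ∃ (K : Type) (_ : Finite K) (_ : TopologicalSpace K) (_ : DiscreteTopology K) (ψ : X → K),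
      Continuous ψ ∧ ∀ f : C(X, X), (∀ x, ψ (f x) = ψ (h x)) → f ∈ W := by
  induction hW with
  | basic W hW =>
    obtain ⟨C, hC, U, hU, rfl⟩ := hW
    obtain ⟨V, hV, h1, h2⟩ : ∃ V : Set X, IsClopen V ∧ h '' C ⊆ V ∧ V ⊆ U :=
       exists_clopen_of_closed_subset_open (hC.image h.continuous).isClosed hU
        (Set.image_subset_iff.2 hh)
    refine ⟨Bool, inferInstance, inferInstance, inferInstance, V.boolIndicator,
      (continuous_boolIndicator_iff_isClopen _).2 hV, fun f hf x hx => h2 ?_⟩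
    rw [Set.mem_iff_boolIndicator, hf, ← Set.mem_iff_boolIndicator]
    exact h1 ⟨x, hx, rfl⟩
  | univ => exact ⟨Unit, inferInstance, inferInstance, inferInstance, fun _ => (),
      continuous_const, fun _ _ => trivial⟩
  | inter W₁ W₂ _ _ ih₁ ih₂ =>
    obtain ⟨K₁, _, _, _, ψ₁, hc₁, h₁⟩ := ih₁ hh.1
    obtain ⟨K₂, _, _, _, ψ₂, hc₂, h₂⟩ := ih₂ hh.2
    exact ⟨K₁ × K₂, inferInstance, inferInstance, inferInstance, fun x => (ψ₁ x, ψ₂ x),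
      hc₁.prodMk hc₂, fun f hf => ⟨h₁ f fun x => congrArg Prod.fst (hf x),
        h₂ f fun x => congrArg Prod.snd (hf x)⟩⟩
  | sUnion S _ ih =>
    obtain ⟨W, hW, hhW⟩ := hh
    obtain ⟨K, h1, h2, h3, ψ, hc, h⟩ := ih W hW hhW
    exact ⟨K, h1, h2, h3, ψ, hc, fun f hf => ⟨W, hW, h f hf⟩⟩

/-- A neighbourhood of a tuple of homeomorphisms contains all tuples which induce no more edges
than it does on the pieces of some finite clopen partition. -/
theorem exists_partition_of_mem_nhds {W : Set (Fin m → (X ≃ₜ X))} {h : Fin m → (X ≃ₜ X)}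
    (hW : W ∈ 𝓝 h) :
    ∃ (K : Type) (_ : Finite K) (_ : TopologicalSpace K) (_ : DiscreteTopology K) (φ : X → K),
      Continuous φ ∧ ∀ f : Fin m → (X ≃ₜ X),
        (∀ i x, ∃ y, φ y = φ x ∧ φ (h i y) = φ (f i x)) → f ∈ W := by
  rw [nhds_pi, Filter.mem_pi'] at hW
  obtain ⟨I, t, ht, htW⟩ := hW
  have key : ∀ i, ∃ (K : Type) (_ : Finite K) (_ : TopologicalSpace K) (_ : DiscreteTopology K)
      (ψ : X → K), Continuous ψ ∧ ∀ f : X ≃ₜ X, (∀ x, ψ (f x) = ψ (h i x)) → f ∈ t i := by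
    intro i
    have hi := ht i
    rw [nhds_induced, Filter.mem_comap] at hi
    obtain ⟨V, hV, hVt⟩ := hi
    obtain ⟨V', hV', ho, hmem⟩ := mem_nhds_iff.1 hV
    obtain ⟨K, h1, h2, h3, ψ, hψ, hψ'⟩ := exists_partition_of_isOpen ho hmem
    exact ⟨K, h1, h2, h3, ψ, hψ, fun f hf => hVt (hV' (hψ' ⟨f, f.continuous⟩ hf))⟩
  choose K h1 h2 h3 ψ hψ hψ' using key
  -- With the pieces and their preimages, an edge from the piece of `x` locates the image of `x`.
  refine ⟨(∀ i, K i) × ((i : Fin m) → K i), inferInstance, inferInstance, inferInstance,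
    fun x => (fun i => ψ i x, fun i => ψ i (h i x)),
    (continuous_pi hψ).prodMk (continuous_pi fun i => (hψ i).comp (h i).continuous),
    fun f hf => htW fun i _ => hψ' i (f i) fun x => ?_⟩
  obtain ⟨y, hy, hy'⟩ := hf i x
  have e1 := congrFun (congrArg Prod.snd hy) i
  have e2 := congrFun (congrArg Prod.fst hy') i
  exact e2.symm.trans e1

end Dense

theorem dense_diagConjClass (hm : 1 ≤ m) {L : TopStr.{u} m}
    (h : IsProjFraisseLimit (AmpleFamily m) L) {F : Fin m → (L ≃ₜ L)}
    (hF : ∀ i x y, L.rel i x y ↔ F i x = y) {X : Type v}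
    [TopologicalSpace X] [CompactSpace X] [T2Space X] [TotallyDisconnectedSpace X]
    [SecondCountableTopology X] [PerfectSpace X] [Nonempty X] (e : L ≃ₜ X) :
    Dense (diagConjClass fun i => (e.symm.trans (F i)).trans e) := by
  refine fun k => mem_closure_iff_nhds.2 fun W hW => ?_
  obtain ⟨K, _, _, _, φ, hφ, hφW⟩ := exists_partition_of_mem_nhds hW
  let E : TopStr.{0} m := ofFinite (Set.range φ) fun i a b => ∃ x, φ x = a ∧ φ (k i x) = b
  let φ' : X → E := Set.rangeFactorization φ
  have hfin : Finite E := inferInstanceAs (Finite (Set.range φ))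
  have hne : Nonempty E := ‹Nonempty X›.map φ'
  have hφ' : Continuous φ' := continuous_of_injective_comp (A := E) (K := K)
    (g := fun z : Set.range φ => z.1) Subtype.val_injective hφ
  have hE : FinSurj E := by
    refine ⟨hfin, hne, ?_⟩
    rintro ⟨i, b⟩ ⟨_, x, rfl⟩
    cases b
    · exact ⟨⟨_, (k i).symm x, rfl⟩, (k i).symm x, rfl, by simp⟩
    · exact ⟨⟨_, k i x, rfl⟩, x, rfl, rfl⟩
  obtain ⟨D, hD, δ, hδ, -⟩ := hE.exists_cover hm
  obtain ⟨ρ, hρ⟩ := h.universal D hD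
  have hρ' := hδ.comp hρ
  obtain ⟨g, hg⟩ := exists_homeomorph_over (hρ'.continuous.comp e.symm.continuous)
    (hρ'.surjective.comp e.symm.surjective) hφ' Set.rangeFactorization_surjective
  refine ⟨fun i => g * ((e.symm.trans (F i)).trans e) * g⁻¹, hφW _ fun i x => ?_, g, fun i => rfl⟩
  obtain ⟨w, rfl⟩ : ∃ w, x = g (e w) := ⟨e.symm (g.symm x), by simp⟩
  obtain ⟨y, hy, hy'⟩ := (hρ'.rel_iff i _ _).2 ⟨w, F i w, rfl, rfl, (hF i _ _).2 rfl⟩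
  have hval : ∀ w, (show Set.range φ from δ (ρ w)).1 = φ (g (e w)) := by
    intro w
    have := hg (e w)
    simp only [Function.comp_apply, e.symm_apply_apply] at this
    exact (congrArg (fun z : Set.range φ => z.1) this).symm
  refine ⟨y, hy.trans (hval w), hy'.trans ((hval _).trans (congrArg φ ?_))⟩
  change _ = g (e (F i (e.symm (g.symm (g (e w))))))
  simp

theorem theorem3p5 (m : ℕ) (hm : 1 ≤ m) :
    IsProjFraisseFamily (AmpleFamily m) ∧
    (∃ L : TopStr.{u} m, IsProjFraisseLimit (AmpleFamily m) L) ∧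
    (∀ L L' : TopStr.{u} m, IsProjFraisseLimit (AmpleFamily m) L →
      IsProjFraisseLimit (AmpleFamily m) L' → ∃ ψ : L → L', TopStr.IsIso L L' ψ) ∧
    ∀ L : TopStr.{u} m, IsProjFraisseLimit (AmpleFamily m) L →
      Nonempty (L ≃ₜ (ℕ → Bool)) ∧
      ∃ F : Fin m → (L ≃ₜ L), (∀ i x y, L.rel i x y ↔ F i x = y) ∧
        ∀ e : L ≃ₜ (ℕ → Bool),
          Dense (diagConjClass fun i => (e.symm.trans (F i)).trans e) ∧
          IsGδ (diagConjClass fun i => (e.symm.trans (F i)).trans e) ∧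
          (diagConjClass fun i => (e.symm.trans (F i)).trans e) ∈
            residual (Fin m → ((ℕ → Bool) ≃ₜ (ℕ → Bool))) := by
  refine ⟨isProjFraisseFamily_ampleFamily hm, exists_isProjFraisseLimit hm,
    fun L L' h h' => h.exists_isIso (fun A hA => hA.finite) h', fun L h => ⟨?_, ?_⟩⟩
  · have := h.perfectSpace hm
    obtain ⟨x⟩ := h.nonempty hm
    obtain ⟨ψ, -⟩ := exists_homeomorph_over (X := L) (Y := ℕ → Bool) (K := Unit)
      (φ := fun _ => ()) (φ' := fun _ => ()) continuous_const (fun _ => ⟨x, rfl⟩)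
      continuous_const (fun _ => ⟨fun _ => true, rfl⟩)
    exact ⟨ψ⟩
  · choose F hF using h.exists_homeomorph hm
    refine ⟨F, hF, fun e => ?_⟩
    have hd := dense_diagConjClass hm h hF e
    have hG : IsGδ (diagConjClass fun i => (e.symm.trans (F i)).trans e) := by
      rw [diagConjClass_eq h hF e]
      exact isGδ_isProjFraisseLimit_graphStr.preimage continuous_toContinuousMaps
    exact ⟨hd, hG, residual_of_dense_Gδ hG hd⟩
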